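/- **Setting.** Let $\ell:\mathbb R^d\times\Xi\to\mathbb R$ be a noisy observation of the loss $L(\theta)=\mathbb E_{\xi\sim P}[\ell(\theta,\xi)]$, where $L$ is continuously differentiable with gradient $g=\nabla L$. Consider the random-perturbation stochastic approximation $$\hat\theta_{k+1}=\hat\theta_k-a_k\,\hat g_k,\qquad \hat g_k=\frac{\ell(\hat\theta_k+c_k\Delta_k,\xi_k^+)-\ell(\hat\theta_k-c_k\Delta_k,\xi_k^-)}{2c_k}\,m_k(\Delta_k),$$ where $\Delta_k$ is a random vector of $\mathbb R^d$, $m_k$ a (possibly random) map $\mathbb R^d\to\mathbb R^d$, $\xi_k^\pm$ are $\Xi$-valued random elements, and $\mathcal F_k$ is the history up to time $k$ (a filtration to which $\hat\theta_k$ is adapted). Write $\mathbb E_k=\mathbb E[\,\cdot\mid\mathcal F_k]$ and $\varepsilon_k^\pm=\ell(\hat\theta_k\pm c_k\Delta_k,\xi_k^\pm)-L(\hat\theta_k\pm c_k\Delta_k)$. **Theorem (almost sure convergence).** Assume: 1. *(Loss)* There are $K$ and $D_1$ such that for each $k\ge K$, almost surely, $L$ is three times continuously differentiable, with all third-order partial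 derivatives bounded by $D_1$ in absolute value, on some open neighbourhood of $\hat\theta_k$ that contains the segment from $\hat\theta_k-c_k\Delta_k$ to $\hat\theta_k+c_k\Delta_k$. 2. *(Perturbation)* $\Delta_k$ is square-integrable and, given $\mathcal F_k$, has mean $0$ and covariance $\Sigma_k^{-1}$, where $\Sigma_k$ is a positive definite $\mathcal F_k$-measurable matrix; $m_k$ is odd and $\mathcal F_k$-measurable; almost surely $\mathbb E_k[m_k(\Delta_k)\Delta_k^{T}]=I$; and there is $D_2$ such that almost surely $\mathbb E_k[\|m_k(\Delta_k)\|^2]\le D_2$ and $\mathbb E_k[\|\Delta_k\|^6\|m_k(\Delta_k)\|^2]\le D_2$ for all $k$. 3. *(Noise)* There is $D_3$ such that almost surely $\mathbb E[\varepsilon_k^+-\varepsilon_k^-\mid\mathcal F_k,\Delta_k]=0$ and $\mathbb E[(\varepsilon_k^+-\varepsilon_k^-)^2\mid\mathcal F_k,\Delta_k]\le D_3$ for all $k$. 4. *(Boundedness and ODE condition)* $\sup_k\|\hat\theta_k\|<\infty$ almost surely; $\theta^*$ is an asymptotically stable solution (Lyapunov stable and locally attractive) of $dx/dt=-g(x)$;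 and, almost surely, $\hat\theta_k$ lies infinitely often in some compact subset of the domain of attraction $D(\theta^*)$, the set of $x_0$ for which the solution of $dx/dt=-g(x)$ with $x(0)=x_0$ exists for all $t\ge0$ and converges to $\theta^*$ (if solutions from $x_0$ are not unique, all those defined on $[0,\infty)$ converge to $\theta^*$). 5. *(Stepsizes)* $a_k>0$, $c_k>0$, $a_k\to0$, $c_k\to0$, $\sum_k a_k=\infty$, $\sum_k a_k^2c_k^{-2}<\infty$. Then $\hat\theta_k\to\theta^*$ almost surely as $k\to\infty$. -/

import Mathlib

open MeasureTheory Filter Topology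

/-- The loss `L(θ) = E_{ξ ∼ P} [ℓ(θ, ξ)]`. -/
noncomputable def expectedLoss {d : ℕ} {Ξ : Type*} [MeasurableSpace Ξ] (P : Measure Ξ)
    (l : EuclideanSpace ℝ (Fin d) → Ξ → ℝ) (x : EuclideanSpace ℝ (Fin d)) : ℝ :=
  ∫ ξ, l x ξ ∂P

/-- The noisy observation is jointly measurable and integrable, and the loss is a continuously
differentiable function (so that its gradient field is continuous). -/
structure IsLossModel {d : ℕ} {Ξ : Type*} [MeasurableSpace Ξ] (P : Measure Ξ)
    (l : EuclideanSpace ℝ (Fin d) → Ξ → ℝ) : Prop where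
  measurable_obs : Measurable (Function.uncurry l)
  integrable_obs : ∀ x, Integrable (l x) P
  contDiff_loss : ContDiff ℝ 1 (expectedLoss P l)

/-- The two-query gradient estimate
`(ℓ(x + c v, ξ⁺) - ℓ(x - c v, ξ⁻)) / (2 c) • w`, where `w` is the image of the perturbation
`v` under the (odd) direction map. -/
noncomputable def gradientEstimate {d : ℕ} {Ξ : Type*}
    (l : EuclideanSpace ℝ (Fin d) → Ξ → ℝ) (c : ℝ) (x v w : EuclideanSpace ℝ (Fin d))
    (ξp ξm : Ξ) : EuclideanSpace ℝ (Fin d) :=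
  ((l (x + c • v) ξp - l (x - c • v) ξm) / (2 * c)) • w

/-- The difference `ε⁺ - ε⁻` of the two observation errors
`ε^± = ℓ(x ± c v, ξ^±) - L(x ± c v)`. -/
noncomputable def noiseDifference {d : ℕ} {Ξ : Type*} [MeasurableSpace Ξ] (P : Measure Ξ)
    (l : EuclideanSpace ℝ (Fin d) → Ξ → ℝ) (c : ℝ) (x v : EuclideanSpace ℝ (Fin d))
    (ξp ξm : Ξ) : ℝ :=
  (l (x + c • v) ξp - expectedLoss P l (x + c • v))
    - (l (x - c • v) ξm - expectedLoss P l (x - c • v))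

/-- The stochastic approximation recursion `θ_{k+1} = θ_k - a_k ĝ_k(θ_k)`, with
iterates adapted to the history `F`. -/
structure IsSAIteration {d : ℕ} {Ω Ξ : Type*} [mΩ : MeasurableSpace Ω] [MeasurableSpace Ξ]
    (F : Filtration ℕ mΩ) (l : EuclideanSpace ℝ (Fin d) → Ξ → ℝ) (a c : ℕ → ℝ)
    (Δ : ℕ → Ω → EuclideanSpace ℝ (Fin d))
    (m : ℕ → Ω → EuclideanSpace ℝ (Fin d) → EuclideanSpace ℝ (Fin d))
    (ξp ξm : ℕ → Ω → Ξ) (θ : ℕ → Ω → EuclideanSpace ℝ (Fin d)) : Prop where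
  adapted : ∀ k, Measurable[F k] (θ k)
  measurable_obs_pos : ∀ k, Measurable (ξp k)
  measurable_obs_neg : ∀ k, Measurable (ξm k)
  step : ∀ k ω, θ (k + 1) ω =
    θ k ω - a k • gradientEstimate l (c k) (θ k ω) (Δ k ω) (m k ω (Δ k ω)) (ξp k ω) (ξm k ω)

/-- From some index on, almost surely, the third derivative of `L` exists continuously and is
bounded (entrywise) by one constant on an open neighbourhood of the iterate which contains the two
query points `θ_k ± c_k Δ_k` and the segment between them. -/
def LossCondition {d : ℕ} {Ω : Type*} [MeasurableSpace Ω] (μ : Measure Ω)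
    (L : EuclideanSpace ℝ (Fin d) → ℝ) (c : ℕ → ℝ)
    (Δ θ : ℕ → Ω → EuclideanSpace ℝ (Fin d)) : Prop :=
  ∃ (K : ℕ) (D : ℝ), ∀ k ≥ K, ∀ᵐ ω ∂μ, ∃ U : Set (EuclideanSpace ℝ (Fin d)),
    IsOpen U ∧
    segment ℝ (θ k ω - c k • Δ k ω) (θ k ω + c k • Δ k ω) ⊆ U ∧
    ContDiffOn ℝ 3 L U ∧
    ∀ x ∈ U, ∀ i : Fin 3 → Fin d,
      |iteratedFDeriv ℝ 3 L x (fun j => EuclideanSpace.single (i j) (1 : ℝ))| ≤ D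

/-- Conditionally on the history `F k`, the perturbation `Δ_k` has mean `0` and covariance
`Σ_k⁻¹`, where `Σ_k` is positive definite and known at time `k`; the direction map `m_k` is odd
and known at time `k`; `E_k[m_k(Δ_k) Δ_kᵀ] = I`; and `E_k[‖m_k(Δ_k)‖²]` and
`E_k[‖Δ_k‖⁶ ‖m_k(Δ_k)‖²]` are bounded uniformly in `k`. -/
structure PerturbationCondition {d : ℕ} {Ω : Type*} [mΩ : MeasurableSpace Ω] (μ : Measure Ω)
    (F : Filtration ℕ mΩ) (Δ : ℕ → Ω → EuclideanSpace ℝ (Fin d))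
    (m : ℕ → Ω → EuclideanSpace ℝ (Fin d) → EuclideanSpace ℝ (Fin d))
    (S : ℕ → Ω → Matrix (Fin d) (Fin d) ℝ) : Prop where
  measurable_pert : ∀ k, Measurable (Δ k)
  measurable_prec : ∀ k i j, Measurable[F k] (fun ω => S k ω i j)
  posDef_prec : ∀ k ω, (S k ω).PosDef
  memLp_pert : ∀ k, MemLp (Δ k) 2 μ
  mean_zero : ∀ k i, μ[fun ω => Δ k ω i | F k] =ᵐ[μ] 0
  covariance : ∀ k i j,
    μ[fun ω => Δ k ω i * Δ k ω j | F k] =ᵐ[μ] fun ω => (S k ω)⁻¹ i j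
  measurable_map : ∀ k,
    Measurable[(F k).prod (inferInstance : MeasurableSpace (EuclideanSpace ℝ (Fin d)))]
      (fun p : Ω × EuclideanSpace ℝ (Fin d) => m k p.1 p.2)
  odd_map : ∀ k ω, Function.Odd (m k ω)
  cross_moment : ∀ k i j,
    Integrable (fun ω => m k ω (Δ k ω) i * Δ k ω j) μ ∧
    μ[fun ω => m k ω (Δ k ω) i * Δ k ω j | F k] =ᵐ[μ]
      fun _ => (1 : Matrix (Fin d) (Fin d) ℝ) i j
  moment_bound : ∃ D : ℝ, ∀ k,
    (Integrable (fun ω => ‖m k ω (Δ k ω)‖ ^ 2) μ ∧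
      μ[fun ω => ‖m k ω (Δ k ω)‖ ^ 2 | F k] ≤ᵐ[μ] fun _ => D) ∧
    (Integrable (fun ω => ‖Δ k ω‖ ^ 6 * ‖m k ω (Δ k ω)‖ ^ 2) μ ∧
      μ[fun ω => ‖Δ k ω‖ ^ 6 * ‖m k ω (Δ k ω)‖ ^ 2 | F k] ≤ᵐ[μ] fun _ => D)

/-- Given the history up to time `k` and the perturbation `Δ_k`, the noise difference
`ε_k⁺ - ε_k⁻` has conditional mean `0` and conditional second moment bounded uniformly in `k`. -/
def NoiseCondition {d : ℕ} {Ω Ξ : Type*} [mΩ : MeasurableSpace Ω] [MeasurableSpace Ξ]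
    (μ : Measure Ω) (F : Filtration ℕ mΩ) (P : Measure Ξ)
    (l : EuclideanSpace ℝ (Fin d) → Ξ → ℝ) (c : ℕ → ℝ)
    (Δ θ : ℕ → Ω → EuclideanSpace ℝ (Fin d)) (ξp ξm : ℕ → Ω → Ξ) : Prop :=
  ∃ D : ℝ, ∀ k,
    MemLp (fun ω => noiseDifference P l (c k) (θ k ω) (Δ k ω) (ξp k ω) (ξm k ω)) 2 μ ∧
    μ[fun ω => noiseDifference P l (c k) (θ k ω) (Δ k ω) (ξp k ω) (ξm k ω)
      | F k ⊔ MeasurableSpace.comap (Δ k) inferInstance] =ᵐ[μ] 0 ∧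
    μ[fun ω => noiseDifference P l (c k) (θ k ω) (Δ k ω) (ξp k ω) (ξm k ω) ^ 2
      | F k ⊔ MeasurableSpace.comap (Δ k) inferInstance] ≤ᵐ[μ] fun _ => D

/-- `x` solves `x' = -g(x)` on the time set `T` (an interval starting at `0`). -/
def IsFlowSolutionOn {d : ℕ} (g : EuclideanSpace ℝ (Fin d) → EuclideanSpace ℝ (Fin d))
    (T : Set ℝ) (x : ℝ → EuclideanSpace ℝ (Fin d)) : Prop :=
  ∀ t ∈ T, HasDerivWithinAt x (-(g (x t))) T t

/-- The domain of attraction of `p` for `x' = -g(x)`: a solution on `[0, ∞)` starting at the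
point exists, and it (when solutions are not unique: each of them) converges to `p`. -/
def domainOfAttraction {d : ℕ} (g : EuclideanSpace ℝ (Fin d) → EuclideanSpace ℝ (Fin d))
    (p : EuclideanSpace ℝ (Fin d)) : Set (EuclideanSpace ℝ (Fin d)) :=
  {x₀ | (∃ x, IsFlowSolutionOn g (Set.Ici 0) x ∧ x 0 = x₀) ∧
    ∀ x, IsFlowSolutionOn g (Set.Ici 0) x → x 0 = x₀ → Tendsto x atTop (𝓝 p)}

/-- `p` is asymptotically stable for `x' = -g(x)`: Lyapunov stable and locally attractive. -/
structure IsAsymptoticallyStable {d : ℕ}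
    (g : EuclideanSpace ℝ (Fin d) → EuclideanSpace ℝ (Fin d))
    (p : EuclideanSpace ℝ (Fin d)) : Prop where
  stable : ∀ ε > 0, ∃ δ > 0, ∀ T ≥ (0 : ℝ), ∀ x, IsFlowSolutionOn g (Set.Icc 0 T) x →
    dist (x 0) p < δ → ∀ t ∈ Set.Icc 0 T, dist (x t) p < ε
  attractive : ∃ δ > 0, Metric.ball p δ ⊆ domainOfAttraction g p

/-- The iterates are almost surely bounded, `p` is asymptotically stable for `x' = -g(x)`, and
almost surely the iterates are infinitely often in some compact subset of the domain of attraction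
of `p`. -/
structure ODECondition {d : ℕ} {Ω : Type*} [MeasurableSpace Ω] (μ : Measure Ω)
    (g : EuclideanSpace ℝ (Fin d) → EuclideanSpace ℝ (Fin d)) (p : EuclideanSpace ℝ (Fin d))
    (θ : ℕ → Ω → EuclideanSpace ℝ (Fin d)) : Prop where
  bounded : ∀ᵐ ω ∂μ, ∃ M : ℝ, ∀ k, ‖θ k ω‖ ≤ M
  stable : IsAsymptoticallyStable g p
  recurrent : ∀ᵐ ω ∂μ, ∃ A : Set (EuclideanSpace ℝ (Fin d)),
    IsCompact A ∧ A ⊆ domainOfAttraction g p ∧ ∃ᶠ k in atTop, θ k ω ∈ A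

/-- The stepsize conditions. -/
structure StepsizeCondition (a c : ℕ → ℝ) : Prop where
  a_pos : ∀ k, 0 < a k
  c_pos : ∀ k, 0 < c k
  a_tendsto : Tendsto a atTop (𝓝 0)
  c_tendsto : Tendsto c atTop (𝓝 0)
  sum_a : Tendsto (fun n => ∑ k ∈ Finset.range n, a k) atTop atTop
  sum_ac : Summable (fun k => a k ^ 2 / c k ^ 2)

/-! The recursion is an Euler scheme for `x' = -g(x)` with two errors: a conditional bias that
vanishes, and martingale noise whose sums converge. Since total step size diverges while individual
steps vanish, the tail of the path follows the flow, and asymptotic stability does the rest.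

Probabilistic half. In the symmetric difference of `L` the second-order terms cancel, so it equals
the directional derivative up to `O(c_k^2 ‖Δ_k‖^3)`. The identity `E_k[m_k(Δ_k) Δ_kᵀ] = I` turns
that derivative into the gradient, leaving a bias `O(c_k^2)`. The noise, divided by `2 c_k`, gives
increments with second moment `O(a_k^2 / c_k^2)`, which is summable, so the compensated sums
converge almost surely (`ae_tendsto_sum_sub_condExp`). These moments require a bounded gradient,
hence the truncation to `‖θ_k‖ ≤ N` in `exists_truncated_increment_moments`; on almost every path
some `N` makes the truncation inactive.

Deterministic half (`tendsto_of_isAsymptoticallyStable`). Ultrafilter limits of shifted paths solve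
the ODE (`exists_flow_limit`). Starting from visits to the compact set, such a limit enters every
ball around the stable point, hence so do the iterates. Infinitely many excursions from a small ball
to a fixed distance would yield a limit solution that either violates Lyapunov stability or returns
to the small ball during the excursion. -/

/-! ### Perturbed Euler schemes and their limiting differential equation -/

/-- The telescoped error bound for a perturbed Euler scheme over the steps between `p` and `q`,
compared with constant velocity `-w`. -/
theorem norm_euler_displacement_le {E : Type*} [NormedAddCommGroup E] [NormedSpace ℝ E]
    {v x S : ℕ → E} {a : ℕ → ℝ} {K : ℕ} (ha : ∀ k, 0 < a k)
    (hx : ∀ k ≥ K, x (k + 1) = x k - a k • v k - (S (k + 1) - S k))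
    {p q : ℕ} (hp : K ≤ p) (hq : K ≤ q) {w : E} {ε : ℝ}
    (hw : ∀ i, min p q ≤ i → i ≤ max p q → ‖v i - w‖ ≤ ε) :
    ‖x q - x p + (∑ i ∈ Finset.range q, a i - ∑ i ∈ Finset.range p, a i) • w‖ ≤
      |∑ i ∈ Finset.range q, a i - ∑ i ∈ Finset.range p, a i| * ε + ‖S q - S p‖ := by
  -- With `S k - S n` kept inside the norm, each step adds only `a k • (v k - w)`; the noise is
  -- split off once, at the end.
  have key : ∀ n, K ≤ n → ∀ k, n ≤ k → (∀ i, n ≤ i → i ≤ k → ‖v i - w‖ ≤ ε) →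
      ‖x k - x n + (∑ i ∈ Finset.range k, a i - ∑ i ∈ Finset.range n, a i) • w + (S k - S n)‖ ≤
        (∑ i ∈ Finset.range k, a i - ∑ i ∈ Finset.range n, a i) * ε := by
    intro n hn k hk
    induction k, hk using Nat.le_induction with
    | base => intro _; simp
    | succ k hk ih =>
      intro h
      have h1 := ih (fun i hi hik => h i hi (by omega))
      have h2 := h k hk (by omega)
      rw [hx k (by omega), Finset.sum_range_succ]
      have : x k - a k • v k - (S (k + 1) - S k) - x n +
          (∑ i ∈ Finset.range k, a i + a k - ∑ i ∈ Finset.range n, a i) • w + (S (k + 1) - S n) =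
          (x k - x n + (∑ i ∈ Finset.range k, a i - ∑ i ∈ Finset.range n, a i) • w + (S k - S n))
          - a k • (v k - w) := by
        module
      rw [this]
      refine (norm_sub_le _ _).trans ?_
      rw [norm_smul, Real.norm_of_nonneg (ha k).le]
      have := mul_le_mul_of_nonneg_left h2 (ha k).le
      linarith
  have mono : Monotone fun k => ∑ i ∈ Finset.range k, a i :=
    monotone_nat_of_le_succ fun k => by
      rw [Finset.sum_range_succ]; linarith [ha k]
  -- Both orders are needed because the limit is later differentiated in time from both sides.
  rcases le_total p q with h | h
  · rw [min_eq_left h, max_eq_right h] at hw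
    have h1 := key p hp q h hw
    have h2 : 0 ≤ ∑ i ∈ Finset.range q, a i - ∑ i ∈ Finset.range p, a i := sub_nonneg.2 (mono h)
    rw [abs_of_nonneg h2]
    have h3 := norm_sub_le (x q - x p +
      (∑ i ∈ Finset.range q, a i - ∑ i ∈ Finset.range p, a i) • w + (S q - S p)) (S q - S p)
    rw [add_sub_cancel_right] at h3
    linarith
  · rw [min_eq_right h, max_eq_left h] at hw
    have h1 := key q hq p h hw
    have h2 : 0 ≤ ∑ i ∈ Finset.range p, a i - ∑ i ∈ Finset.range q, a i := sub_nonneg.2 (mono h)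
    rw [abs_sub_comm, abs_of_nonneg h2]
    have h3 := norm_sub_le (x p - x q +
      (∑ i ∈ Finset.range p, a i - ∑ i ∈ Finset.range q, a i) • w + (S p - S q)) (S p - S q)
    rw [add_sub_cancel_right, norm_sub_rev (S p)] at h3
    rw [← norm_neg]
    have h4 : -(x q - x p + (∑ i ∈ Finset.range q, a i - ∑ i ∈ Finset.range p, a i) • w) =
      x p - x q + (∑ i ∈ Finset.range p, a i - ∑ i ∈ Finset.range q, a i) • w := by module
    rw [h4]
    linarith

/-- If the step sizes vanish and have divergent sum, every elapsed time `s ≥ 0` is reached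
asymptotically from every starting index. -/
theorem exists_index_elapsed_time_tendsto {a : ℕ → ℝ}
    (ha0 : Tendsto a atTop (𝓝 0))
    (hsum : Tendsto (fun n => ∑ k ∈ Finset.range n, a k) atTop atTop) {s : ℝ} (hs : 0 ≤ s) :
    ∃ κ : ℕ → ℕ, (∀ n, n ≤ κ n) ∧
      Tendsto (fun n => ∑ i ∈ Finset.range (κ n), a i - ∑ i ∈ Finset.range n, a i)
        atTop (𝓝 s) := by
  classical
  have hex : ∀ n, ∃ k, n ≤ k ∧ ∑ i ∈ Finset.range n, a i + s ≤ ∑ i ∈ Finset.range k, a i :=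
    fun n => ((eventually_ge_atTop n).and (hsum.eventually_ge_atTop _)).exists
  -- Taking the first index whose elapsed time reaches `s` makes the overshoot smaller than the last
  -- step, which vanishes.
  refine ⟨fun n => Nat.find (hex n), fun n => (Nat.find_spec (hex n)).1, ?_⟩
  rw [Metric.tendsto_atTop]
  intro ε hε
  obtain ⟨N, hN⟩ := eventually_atTop.1 (ha0.eventually (gt_mem_nhds hε))
  refine ⟨N, fun n hn => ?_⟩
  obtain ⟨h1, h2⟩ := Nat.find_spec (hex n)
  have hmin := fun k => Nat.find_min (hex n) (m := k)
  rw [Real.dist_eq, abs_lt]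
  beta_reduce
  generalize Nat.find (hex n) = k at *
  refine ⟨by linarith, ?_⟩
  rcases h1.eq_or_lt with h | h
  · subst h; simp; linarith
  · obtain ⟨j, rfl⟩ : ∃ j, k = j + 1 := ⟨k - 1, by omega⟩
    have h3 := hmin j (by omega)
    have h4 : ¬ (∑ i ∈ Finset.range n, a i + s ≤ ∑ i ∈ Finset.range j, a i) :=
      fun h' => h3 ⟨by omega, h'⟩
    have := hN j (by omega)
    rw [Finset.sum_range_succ]
    linarith

/-- Limits along an ultrafilter of the shifted trajectories of a bounded, asymptotically noiseless
Euler scheme are solutions of the differential equation `y' = -g(y)` on `[0, ∞)`. -/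
theorem exists_flow_limit {d : ℕ}
    {g : EuclideanSpace ℝ (Fin d) → EuclideanSpace ℝ (Fin d)} (hg : Continuous g)
    {x b S : ℕ → EuclideanSpace ℝ (Fin d)} {a : ℕ → ℝ} {K : ℕ} {M : ℝ}
    (ha : ∀ k, 0 < a k) (ha0 : Tendsto a atTop (𝓝 0))
    (hsum : Tendsto (fun n => ∑ k ∈ Finset.range n, a k) atTop atTop)
    (hM : ∀ k, ‖x k‖ ≤ M) (hb : Tendsto b atTop (𝓝 0)) (hS : CauchySeq S)
    (hx : ∀ k ≥ K, x (k + 1) = x k - a k • (g (x k) + b k) - (S (k + 1) - S k))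
    (U : Ultrafilter ℕ) (hU : (U : Filter ℕ) ≤ atTop) :
    ∃ y, IsFlowSolutionOn g (Set.Ici 0) y ∧ ∀ s ≥ 0, ∀ p : ℕ → ℕ, (∀ᶠ n in U, n ≤ p n) →
      Tendsto (fun n => ∑ i ∈ Finset.range (p n), a i - ∑ i ∈ Finset.range n, a i) U (𝓝 s) →
      Tendsto (fun n => x (p n)) U (𝓝 (y s)) := by
  have hMx : ∀ k, x k ∈ Metric.closedBall (0 : EuclideanSpace ℝ (Fin d)) M := fun k => by
    simpa using hM k
  obtain ⟨G, hG⟩ :=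
    (isCompact_closedBall (0 : EuclideanSpace ℝ (Fin d)) M).exists_bound_of_continuousOn
    hg.continuousOn
  have hG0 : 0 ≤ G := (norm_nonneg _).trans (hG _ (hMx 0))
  -- Asymptotic equicontinuity: comparison with velocity `0` shows the path is `(G + 1)`-Lipschitz
  -- in elapsed time up to `σ`.
  have hcmp : ∀ σ > 0, ∃ N, ∀ p ≥ N, ∀ q ≥ N, ‖x q - x p‖ ≤
      |∑ i ∈ Finset.range q, a i - ∑ i ∈ Finset.range p, a i| * (G + 1) + σ := by
    intro σ hσ
    obtain ⟨N1, hN1⟩ := Metric.cauchySeq_iff.1 hS σ hσ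
    obtain ⟨N2, hN2⟩ := Metric.tendsto_atTop.1 hb 1 one_pos
    refine ⟨max K (max N1 N2), fun p hp q hq => ?_⟩
    have h1 := norm_euler_displacement_le (v := fun k => g (x k) + b k) ha hx (p := p) (q := q)
      (w := 0) (ε := G + 1) (le_trans (le_max_left _ _) hp) (le_trans (le_max_left _ _) hq) ?_
    · have h2 := hN1 q (by omega) p (by omega)
      rw [dist_eq_norm] at h2
      simp only [smul_zero, add_zero] at h1
      linarith
    · intro i hi _
      have h3 := hN2 i (by omega)
      rw [dist_zero_right] at h3
      rw [sub_zero]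
      exact (norm_add_le _ _).trans (add_le_add (hG _ (hMx i)) h3.le)
  choose! κ hκ hκt using fun (s : ℝ) (hs : 0 ≤ s) =>
    exists_index_elapsed_time_tendsto ha0 hsum hs
  -- One ultrafilter gives limits at all times `s` at once, in place of Arzelà–Ascoli and a diagonal
  -- subsequence.
  have hlim : ∀ s, ∃ z, Tendsto (fun n => x (κ s n)) U (𝓝 z) := fun s => by
    obtain ⟨z, -, hz⟩ := (isCompact_closedBall (0 : EuclideanSpace ℝ (Fin d)) M).ultrafilter_le_nhds
      (U.map fun n => x (κ s n))
      (by
        rw [Ultrafilter.coe_map, le_principal_iff, mem_map]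
        exact Filter.univ_mem' fun n => hMx (κ s n))
    rw [Ultrafilter.coe_map] at hz
    exact ⟨z, hz⟩
  choose y hy using hlim
  have hUge : ∀ N, ∀ᶠ n in (U : Filter ℕ), N ≤ n := fun N => hU (eventually_ge_atTop N)
  refine ⟨y, ?_, ?_⟩
  · intro s hs
    have hs' : 0 ≤ s := hs
    rw [hasDerivWithinAt_iff_isLittleO, Asymptotics.isLittleO_iff]
    intro ε hε
    obtain ⟨η, hη, hgη⟩ := Metric.continuousAt_iff.1 (hg.continuousAt (x := y s)) (ε / 2)
      (half_pos hε)
    -- The intermediate iterates stay within `η` of `y s`: drift, noise and the initial error each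
    -- cost at most `η / 4`.
    have hr : 0 < η / (4 * (G + 1)) := by positivity
    filter_upwards [self_mem_nhdsWithin,
      mem_nhdsWithin_of_mem_nhds (Metric.ball_mem_nhds s hr)] with u hu hur
    have hu' : 0 ≤ u := hu
    rw [Metric.mem_ball, Real.dist_eq, lt_div_iff₀ (by positivity)] at hur
    have hκsu : Tendsto (fun n => ∑ i ∈ Finset.range (κ u n), a i -
        ∑ i ∈ Finset.range (κ s n), a i) U (𝓝 (u - s)) := by
      refine (((hκt u hu').sub (hκt s hs')).mono_left hU).congr fun n => ?_
      ring
    have hSd : Tendsto (fun n => ‖S (κ u n) - S (κ s n)‖) U (𝓝 0) := by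
      obtain ⟨z, hz⟩ := cauchySeq_tendsto_of_complete hS
      have h : ∀ v, 0 ≤ v → Tendsto (κ v) U atTop := fun v hv =>
        (tendsto_atTop_mono (hκ v hv) tendsto_id).mono_left hU
      simpa using ((hz.comp (h u hu')).sub (hz.comp (h s hs'))).norm
    obtain ⟨N, hN⟩ := hcmp (η / 4) (by positivity)
    obtain ⟨N2, hN2⟩ := Metric.tendsto_atTop.1 hb (ε / 2) (half_pos hε)
    have hev : ∀ᶠ n in U, ‖x (κ u n) - x (κ s n) + (∑ i ∈ Finset.range (κ u n), a i -
        ∑ i ∈ Finset.range (κ s n), a i) • g (y s)‖ ≤ |∑ i ∈ Finset.range (κ u n), a i -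
        ∑ i ∈ Finset.range (κ s n), a i| * ε + ‖S (κ u n) - S (κ s n)‖ := by
      have h1 : ∀ᶠ n in U, |∑ i ∈ Finset.range (κ u n), a i -
          ∑ i ∈ Finset.range (κ s n), a i| * (G + 1) < η / 4 := by
        refine (hκsu.abs.mul_const (G + 1)).eventually (gt_mem_nhds ?_)
        linarith
      have h2 : ∀ᶠ n in U, dist (x (κ s n)) (y s) < η / 4 :=
        (hy s).eventually (Metric.ball_mem_nhds _ (by positivity))
      filter_upwards [h1, h2, hUge (max K (max N N2))] with n h1 h2 hn
      have hks := hκ s hs' n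
      have hku := hκ u hu' n
      refine norm_euler_displacement_le (v := fun k => g (x k) + b k) ha hx (by omega) (by omega) ?_
      intro i hi hi'
      have mono : Monotone fun k => ∑ i ∈ Finset.range k, a i :=
        monotone_nat_of_le_succ fun k => by
          rw [Finset.sum_range_succ]; linarith [ha k]
      have h3 : |∑ j ∈ Finset.range i, a j - ∑ j ∈ Finset.range (κ s n), a j| ≤
          |∑ i ∈ Finset.range (κ u n), a i - ∑ i ∈ Finset.range (κ s n), a i| := by
        rcases le_total (κ s n) (κ u n) with h | h
        · rw [min_eq_left h] at hi
          rw [max_eq_right h] at hi'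
          have e1 := mono hi
          have e2 := mono hi'
          simp only at e1 e2
          rw [abs_of_nonneg (by linarith), abs_of_nonneg (by linarith)]
          linarith
        · rw [min_eq_right h] at hi
          rw [max_eq_left h] at hi'
          have e1 := mono hi
          have e2 := mono hi'
          simp only at e1 e2
          rw [abs_of_nonpos (by linarith), abs_of_nonpos (by linarith)]
          linarith
      have h4 := hN (κ s n) (by omega) i (by omega)
      have h5 : dist (x i) (y s) < η := by
        refine (dist_triangle _ (x (κ s n)) _).trans_lt ?_
        rw [dist_eq_norm]
        have := mul_le_mul_of_nonneg_right h3 (by positivity : 0 ≤ G + 1)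
        linarith
      have h6 := hgη h5
      have h7 := hN2 i (by omega)
      rw [dist_zero_right] at h7
      rw [dist_eq_norm] at h6
      have h8 : g (x i) + b i - g (y s) = (g (x i) - g (y s)) + b i := by abel
      rw [h8]
      exact (norm_add_le _ _).trans (by linarith)
    -- The limit reads `‖y u - y s + (u - s) • g (y s)‖ ≤ |u - s| * ε`, the required little-o bound.
    have hfin := le_of_tendsto_of_tendsto
      ((((hy u).sub (hy s)).add (hκsu.smul_const (g (y s)))).norm)
      ((hκsu.abs.mul_const ε).add hSd) hev
    rw [add_zero] at hfin
    rw [smul_neg, sub_neg_eq_add, Real.norm_eq_abs, mul_comm ε]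
    exact hfin
  · intro s hs p hp hpt
    have hd : Tendsto (fun n => ∑ i ∈ Finset.range (p n), a i -
        ∑ i ∈ Finset.range (κ s n), a i) U (𝓝 0) := by
      have := hpt.sub ((hκt s hs).mono_left hU)
      rw [sub_self] at this
      refine this.congr fun n => ?_
      ring
    have h0 : Tendsto (fun n => x (p n) - x (κ s n)) U (𝓝 0) := by
      rw [Metric.tendsto_nhds]
      intro ε hε
      obtain ⟨N, hN⟩ := hcmp (ε / 2) (half_pos hε)
      have h1 : ∀ᶠ n in U, |∑ i ∈ Finset.range (p n), a i -
          ∑ i ∈ Finset.range (κ s n), a i| * (G + 1) < ε / 2 := by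
        refine (hd.abs.mul_const (G + 1)).eventually (gt_mem_nhds ?_)
        simpa using hε
      filter_upwards [h1, hp, hUge N] with n h1 h2 h3
      have := hN (κ s n) (h3.trans (hκ s hs n)) (p n) (h3.trans h2)
      rw [dist_zero_right]
      linarith
    simpa using h0.add (hy s)

/-! ### Convergence to an asymptotically stable point -/

/-- **Kushner–Clark lemma**: a bounded, asymptotically noiseless Euler scheme which returns
infinitely often to a compact subset of the domain of attraction of an asymptotically stable point
converges to that point. -/
theorem tendsto_of_isAsymptoticallyStable {d : ℕ}
    {g : EuclideanSpace ℝ (Fin d) → EuclideanSpace ℝ (Fin d)} (hg : Continuous g)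
    {x b S : ℕ → EuclideanSpace ℝ (Fin d)} {a : ℕ → ℝ} {K : ℕ} {M : ℝ}
    (ha : ∀ k, 0 < a k) (ha0 : Tendsto a atTop (𝓝 0))
    (hsum : Tendsto (fun n => ∑ k ∈ Finset.range n, a k) atTop atTop)
    (hM : ∀ k, ‖x k‖ ≤ M) (hb : Tendsto b atTop (𝓝 0)) (hS : CauchySeq S)
    (hx : ∀ k ≥ K, x (k + 1) = x k - a k • (g (x k) + b k) - (S (k + 1) - S k))
    {z : EuclideanSpace ℝ (Fin d)} (hz : IsAsymptoticallyStable g z)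
    {A : Set (EuclideanSpace ℝ (Fin d))} (hA : IsCompact A) (hAz : A ⊆ domainOfAttraction g z)
    (hxA : ∃ᶠ k in atTop, x k ∈ A) : Tendsto x atTop (𝓝 z) := by
  have visit : ∀ δ > 0, ∃ᶠ k in atTop, dist (x k) z < δ := by
    intro δ hδ
    have : NeBot (atTop ⊓ 𝓟 {k | x k ∈ A}) := frequently_mem_iff_neBot.1 hxA
    set U := Ultrafilter.of (atTop ⊓ 𝓟 {k | x k ∈ A}) with hUdef
    have hU := Ultrafilter.of_le (atTop ⊓ 𝓟 {k | x k ∈ A})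
    have hU1 : (U : Filter ℕ) ≤ atTop := hU.trans inf_le_left
    have hU2 : ∀ᶠ n in U, x n ∈ A := le_principal_iff.1 (hU.trans inf_le_right)
    obtain ⟨y, hy, hyl⟩ := exists_flow_limit hg ha ha0 hsum hM hb hS hx U hU1
    have h0 : Tendsto x U (𝓝 (y 0)) :=
      hyl 0 le_rfl id (Eventually.of_forall fun _ => le_rfl) (by simp)
    have h1 := (hAz (hA.isClosed.mem_of_tendsto h0 hU2)).2 y hy rfl
    obtain ⟨T, hT, hT0⟩ := ((h1.eventually (Metric.ball_mem_nhds z hδ)).and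
      (eventually_ge_atTop 0)).exists
    obtain ⟨κ, hκ, hκt⟩ := exists_index_elapsed_time_tendsto ha0 hsum hT0
    have h2 := hyl T hT0 κ (Eventually.of_forall hκ) (hκt.mono_left hU1)
    rw [Filter.frequently_atTop]
    intro N
    obtain ⟨n, hn, hnN⟩ := ((h2.eventually (Metric.isOpen_ball.mem_nhds hT)).and
      (hU1 (eventually_ge_atTop N))).exists
    exact ⟨κ n, le_trans hnN (hκ n), hn⟩
  by_contra hcon
  obtain ⟨ε, hε, hfar⟩ : ∃ ε > 0, ∃ᶠ k in atTop, ε ≤ dist (x k) z := by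
    rw [Metric.tendsto_nhds] at hcon
    push Not at hcon
    exact hcon
  obtain ⟨δ₁, hδ₁, hst⟩ := hz.stable (ε / 2) (half_pos hε)
  obtain ⟨δ₂, hδ₂, hat⟩ := hz.attractive
  obtain ⟨δ, hδ, hδ1, hδ2, hδε⟩ : ∃ δ > 0, δ < δ₁ ∧ δ < δ₂ ∧ δ < ε :=
    ⟨min δ₁ (min δ₂ ε) / 2, by positivity, by
      have := min_le_left δ₁ (min δ₂ ε); linarith, by
      have := (min_le_right δ₁ (min δ₂ ε)).trans (min_le_left _ _); linarith, by
      have := (min_le_right δ₁ (min δ₂ ε)).trans (min_le_right _ _); linarith⟩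
  -- Here `n` is the last visit to the `δ`-ball before a time `m` at distance at least `ε`.
  have hexc : ∃ᶠ n in atTop, dist (x n) z < δ ∧
      ∃ m, n ≤ m ∧ ε ≤ dist (x m) z ∧ ∀ i, n < i → i ≤ m → δ ≤ dist (x i) z := by
    classical
    rw [Filter.frequently_atTop]
    intro N
    obtain ⟨n₀, hn₀, hn₀δ⟩ := Filter.frequently_atTop.1 (visit δ hδ) N
    obtain ⟨m, hm, hmε⟩ := Filter.frequently_atTop.1 hfar n₀
    refine ⟨Nat.findGreatest (fun k => dist (x k) z < δ) m, ?_, ?_, m,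
      Nat.findGreatest_le m, hmε, ?_⟩
    · exact le_trans hn₀ (Nat.le_findGreatest hm hn₀δ)
    · exact Nat.findGreatest_spec (P := fun k => dist (x k) z < δ) hm hn₀δ
    · intro i hi him
      exact not_lt.1 (Nat.findGreatest_is_greatest hi him)
  have : NeBot (atTop ⊓ 𝓟 {n | dist (x n) z < δ ∧
      ∃ m, n ≤ m ∧ ε ≤ dist (x m) z ∧ ∀ i, n < i → i ≤ m → δ ≤ dist (x i) z}) :=
    frequently_mem_iff_neBot.1 hexc
  set J := {n | dist (x n) z < δ ∧
      ∃ m, n ≤ m ∧ ε ≤ dist (x m) z ∧ ∀ i, n < i → i ≤ m → δ ≤ dist (x i) z} with hJ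
  set U := Ultrafilter.of (atTop ⊓ 𝓟 J) with hUdef
  have hU := Ultrafilter.of_le (atTop ⊓ 𝓟 J)
  have hU1 : (U : Filter ℕ) ≤ atTop := hU.trans inf_le_left
  have hU2 : ∀ᶠ n in U, n ∈ J := le_principal_iff.1 (hU.trans inf_le_right)
  obtain ⟨y, hy, hyl⟩ := exists_flow_limit hg ha ha0 hsum hM hb hS hx U hU1
  have h0 : Tendsto x U (𝓝 (y 0)) :=
    hyl 0 le_rfl id (Eventually.of_forall fun _ => le_rfl) (by simp)
  have hy0 : dist (y 0) z ≤ δ :=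
    le_of_tendsto (h0.dist tendsto_const_nhds) (hU2.mono fun n hn => hn.1.le)
  have hyz : Tendsto y atTop (𝓝 z) :=
    (hat (Metric.mem_ball.2 (hy0.trans_lt hδ2))).2 y hy rfl
  have hyst : ∀ t ≥ 0, dist (y t) z < ε / 2 := fun t ht =>
    hst t ht y (fun s hs => (hy s hs.1).mono fun r hr => hr.1) (hy0.trans_lt hδ1) t
      (Set.right_mem_Icc.2 ht)
  choose! m hm using fun n (hn : n ∈ J) => hn.2
  have hm1 : ∀ᶠ n in U, n ≤ m n := hU2.mono fun n hn => (hm n hn).1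
  have mono : Monotone fun k => ∑ i ∈ Finset.range k, a i :=
    monotone_nat_of_le_succ fun k => by
      rw [Finset.sum_range_succ]; linarith [ha k]
  -- If the excursion durations are bounded, they converge to some `σ` along `U` and `y σ` is at
  -- distance at least `ε`, against stability. Otherwise they eventually exceed every bound along
  -- the ultrafilter, and `y` re-enters the `δ`-ball before the excursion ends.
  by_cases hbd : ∃ T, ∀ᶠ n in U,
      ∑ i ∈ Finset.range (m n), a i - ∑ i ∈ Finset.range n, a i ≤ T
  · obtain ⟨T, hT⟩ := hbd
    obtain ⟨σ, hσ, hσl⟩ := (isCompact_Icc (a := (0 : ℝ)) (b := T)).ultrafilter_le_nhds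
      (U.map fun n => ∑ i ∈ Finset.range (m n), a i - ∑ i ∈ Finset.range n, a i) (by
        rw [Ultrafilter.coe_map, le_principal_iff, mem_map]
        filter_upwards [hT, hm1] with n h1 h2
        exact ⟨sub_nonneg.2 (mono h2), h1⟩)
    have h1 := hyl σ hσ.1 m hm1 hσl
    have h2 : ε ≤ dist (y σ) z :=
      ge_of_tendsto (h1.dist tendsto_const_nhds) (hU2.mono fun n hn => (hm n hn).2.1)
    linarith [hyst σ hσ.1]
  · push Not at hbd
    -- Strict positivity of `T` puts the return strictly after `n`; the margin `T + 1` below puts it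
    -- no later than `m n`.
    obtain ⟨T, hT, hT0⟩ := ((hyz.eventually (Metric.ball_mem_nhds z hδ)).and
      (eventually_gt_atTop 0)).exists
    obtain ⟨κ, hκ, hκt⟩ := exists_index_elapsed_time_tendsto ha0 hsum hT0.le
    have hκt' := hκt.mono_left hU1
    have h2 := hyl T hT0.le κ (Eventually.of_forall hκ) hκt'
    have h3 : ∀ᶠ n in U, T + 1 <
        ∑ i ∈ Finset.range (m n), a i - ∑ i ∈ Finset.range n, a i := hbd (T + 1)
    obtain ⟨n, hn1, hn2, hn3, hn4, hn5⟩ := (h3.and (hU2.and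
      ((hκt'.eventually (gt_mem_nhds (by linarith : T < T + 1))).and
      ((hκt'.eventually (lt_mem_nhds hT0)).and
      (h2.eventually (Metric.isOpen_ball.mem_nhds hT)))))).exists
    have hlt1 : n < κ n := by
      refine lt_of_le_of_ne (hκ n) fun h => ?_
      rw [← h, sub_self] at hn4
      exact lt_irrefl _ hn4
    have hlt2 : κ n ≤ m n := by
      by_contra h
      have := mono (not_le.1 h).le
      simp only at this
      linarith
    exact absurd hn5 (not_lt.2 ((hm n hn2).2.2 (κ n) hlt1 hlt2))

/-! ### Third-order Taylor estimate for the symmetric difference -/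

/-- The values of a multilinear form are controlled by its entries on the standard basis. -/
theorem abs_multilinear_le_of_entries_le {d n : ℕ}
    (f : ContinuousMultilinearMap ℝ (fun _ : Fin n => EuclideanSpace ℝ (Fin d)) ℝ) {D : ℝ}
    (hD : ∀ i : Fin n → Fin d, |f fun j => EuclideanSpace.single (i j) (1 : ℝ)| ≤ D)
    (v : EuclideanSpace ℝ (Fin d)) :
    |f fun _ => v| ≤ (d : ℝ) ^ n * |D| * ‖v‖ ^ n := by
  have hv : v = ∑ i, v i • EuclideanSpace.single i (1 : ℝ) := by
    simpa using ((EuclideanSpace.basisFun (Fin d) ℝ).sum_repr v).symm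
  have h1 : f (fun _ => v) = ∑ i : Fin n → Fin d,
      (∏ j, v (i j)) * f fun j => EuclideanSpace.single (i j) (1 : ℝ) := by
    conv_lhs => rw [hv]
    rw [f.map_sum]
    refine Finset.sum_congr rfl fun i _ => ?_
    rw [f.map_smul_univ, smul_eq_mul]
  rw [h1]
  have h2 : ∀ i : Fin n → Fin d,
      |(∏ j, v (i j)) * f fun j => EuclideanSpace.single (i j) (1 : ℝ)| ≤ ‖v‖ ^ n * |D| := by
    intro i
    rw [abs_mul, Finset.abs_prod]
    refine mul_le_mul ?_ ((hD i).trans (le_abs_self D)) (abs_nonneg _) (by positivity)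
    calc ∏ j, |v (i j)| ≤ ∏ _j : Fin n, ‖v‖ :=
          Finset.prod_le_prod (fun _ _ => abs_nonneg _) fun j _ => PiLp.norm_apply_le v (i j)
      _ = ‖v‖ ^ n := by simp
  calc _ ≤ ∑ i : Fin n → Fin d, |(∏ j, v (i j)) * f fun j => EuclideanSpace.single (i j) (1 : ℝ)| :=
        Finset.abs_sum_le_sum_abs _ _
    _ ≤ ∑ _i : Fin n → Fin d, ‖v‖ ^ n * |D| := Finset.sum_le_sum fun i _ => h2 i
    _ = (d : ℝ) ^ n * |D| * ‖v‖ ^ n := by simp; ring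

/-- Third-order error bound for the symmetric difference of a function of one variable. -/
theorem abs_symmetric_difference_le {f₀ f₁ f₂ f₃ : ℝ → ℝ} {B : ℝ}
    (h₀ : ∀ t ∈ Set.Icc (-1 : ℝ) 1, HasDerivAt f₀ (f₁ t) t)
    (h₁ : ∀ t ∈ Set.Icc (-1 : ℝ) 1, HasDerivAt f₁ (f₂ t) t)
    (h₂ : ∀ t ∈ Set.Icc (-1 : ℝ) 1, HasDerivAt f₂ (f₃ t) t)
    (hB : ∀ t ∈ Set.Icc (-1 : ℝ) 1, |f₃ t| ≤ B) :
    |f₀ 1 - f₀ (-1) - 2 * f₁ 0| ≤ 2 * B := by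
  have hneg : ∀ t ∈ Set.Icc (0 : ℝ) 1, -t ∈ Set.Icc (-1 : ℝ) 1 := fun t ht =>
    ⟨by linarith [ht.2], by linarith [ht.1]⟩
  have hpos : ∀ t ∈ Set.Icc (0 : ℝ) 1, t ∈ Set.Icc (-1 : ℝ) 1 := fun t ht =>
    ⟨by linarith [ht.1], ht.2⟩
  have hB0 : 0 ≤ B := (abs_nonneg _).trans (hB 0 (by norm_num))
  -- Integrating from `0` over length at most `1` preserves the bound `2 * B`. It is applied three
  -- times, to symmetrised combinations vanishing at `0`; the constant is not sharp.
  have mvt : ∀ F F' : ℝ → ℝ, F 0 = 0 → (∀ t ∈ Set.Icc (0 : ℝ) 1, HasDerivAt F (F' t) t) →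
      (∀ t ∈ Set.Icc (0 : ℝ) 1, |F' t| ≤ 2 * B) → ∀ t ∈ Set.Icc (0 : ℝ) 1, |F t| ≤ 2 * B := by
    intro F F' hF0 hF hF' t ht
    have := (convex_Icc (0 : ℝ) 1).norm_image_sub_le_of_norm_hasDerivWithin_le
      (fun s hs => (hF s hs).hasDerivWithinAt) hF' (Set.left_mem_Icc.2 zero_le_one) ht
    rw [hF0, sub_zero, sub_zero, Real.norm_eq_abs, Real.norm_eq_abs, abs_of_nonneg ht.1] at this
    exact this.trans (by nlinarith [ht.2])
  have e₂ := mvt (fun t => f₂ t - f₂ (-t)) (fun t => f₃ t + f₃ (-t)) (by simp)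
    (fun t ht => by
      have := (h₂ t (hpos t ht)).sub ((h₂ (-t) (hneg t ht)).comp t (hasDerivAt_neg t))
      exact this.congr_deriv (by ring))
    (fun t ht => (abs_add_le _ _).trans (by
      linarith [hB t (hpos t ht), hB (-t) (hneg t ht)]))
  have e₁ := mvt (fun t => f₁ t + f₁ (-t) - 2 * f₁ 0) (fun t => f₂ t - f₂ (-t))
    (by simp; ring)
    (fun t ht => by
      have := ((h₁ t (hpos t ht)).add ((h₁ (-t) (hneg t ht)).comp t (hasDerivAt_neg t))).sub_const
        (2 * f₁ 0)
      exact this.congr_deriv (by ring)) e₂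
  have e₀ := mvt (fun t => f₀ t - f₀ (-t) - t * (2 * f₁ 0)) (fun t => f₁ t + f₁ (-t) - 2 * f₁ 0)
    (by simp)
    (fun t ht => by
      have := ((h₀ t (hpos t ht)).sub ((h₀ (-t) (hneg t ht)).comp t (hasDerivAt_neg t))).sub
        ((hasDerivAt_id t).mul_const (2 * f₁ 0))
      exact this.congr_deriv (by ring)) e₁ 1 (by norm_num)
  simpa using e₀

/-- Third-order error bound for the symmetric difference of a function whose third-order partial
derivatives are bounded on a neighbourhood of the segment. -/
theorem abs_symmetric_difference_sub_inner_gradient_le {d : ℕ} {L : EuclideanSpace ℝ (Fin d) → ℝ}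
    {x v : EuclideanSpace ℝ (Fin d)} {U : Set (EuclideanSpace ℝ (Fin d))} {D : ℝ} (hU : IsOpen U)
    (hseg : segment ℝ (x - v) (x + v) ⊆ U) (hL : ContDiffOn ℝ 3 L U)
    (hD : ∀ y ∈ U, ∀ i : Fin 3 → Fin d,
      |iteratedFDeriv ℝ 3 L y (fun j => EuclideanSpace.single (i j) (1 : ℝ))| ≤ D) :
    |L (x + v) - L (x - v) - 2 * inner ℝ (gradient L x) v| ≤
      2 * ((d : ℝ) ^ 3 * |D| * ‖v‖ ^ 3) := by
  have hmem : ∀ t ∈ Set.Icc (-1 : ℝ) 1, x + t • v ∈ U := by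
    intro t ht
    refine hseg ⟨(1 - t) / 2, (1 + t) / 2, by linarith [ht.2], by linarith [ht.1], by ring, ?_⟩
    module
  have hcd : ∀ t ∈ Set.Icc (-1 : ℝ) 1, ContDiffAt ℝ 3 L (x + t • v) := fun t ht =>
    hL.contDiffAt (hU.mem_nhds (hmem t ht))
  have hder : ∀ n : ℕ, n < 3 → ∀ t ∈ Set.Icc (-1 : ℝ) 1,
      HasDerivAt (fun s : ℝ => iteratedFDeriv ℝ n L (x + s • v) fun _ => v)
        (iteratedFDeriv ℝ (n + 1) L (x + t • v) fun _ => v) t := by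
    intro n hn t ht
    have h1 : DifferentiableAt ℝ (iteratedFDeriv ℝ n L) (x + t • v) :=
      (hcd t ht).differentiableAt_iteratedFDeriv (by exact_mod_cast hn)
    have h2 : HasDerivAt (fun s : ℝ => x + s • v) v t := by
      simpa using ((hasDerivAt_id t).smul_const v).const_add x
    have h3 := h1.hasFDerivAt.comp_hasDerivAt t h2
    have h4 := ((ContinuousMultilinearMap.apply ℝ
      (fun _ : Fin n => EuclideanSpace ℝ (Fin d)) ℝ (fun _ => v)).hasFDerivAt).comp_hasDerivAt t h3
    exact h4
  have key := abs_symmetric_difference_le (hder 0 (by norm_num)) (hder 1 (by norm_num))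
    (hder 2 (by norm_num)) fun t ht =>
      abs_multilinear_le_of_entries_le _ (hD _ (hmem t ht)) v
  have h0 : iteratedFDeriv ℝ (0 + 1) L (x + (0 : ℝ) • v) (fun _ => v) =
      inner ℝ (gradient L x) v := by
    rw [zero_smul, add_zero, zero_add, iteratedFDeriv_one_apply, gradient,
      InnerProductSpace.toDual_symm_apply]
  rw [h0] at key
  simpa [sub_eq_add_neg] using key

/-! ### Square-summable martingales and conditional moment bounds -/

/-- The centring of a random variable by a conditional expectation decreases its second moment. -/
theorem integral_sub_condExp_sq_le {Ω : Type*} {m mΩ : MeasurableSpace Ω} (hm : m ≤ mΩ)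
    {μ : Measure Ω} [IsProbabilityMeasure μ] {X : Ω → ℝ} (hX : MemLp X 2 μ) :
    ∫ ω, (X ω - (μ[X | m]) ω) ^ 2 ∂μ ≤ ∫ ω, X ω ^ 2 ∂μ := by
  have h1 := ProbabilityTheory.integral_condVar_add_variance_condExp hm hX
  have h2 : ∫ ω, (ProbabilityTheory.condVar m X μ) ω ∂μ = ∫ ω, (X ω - (μ[X | m]) ω) ^ 2 ∂μ :=
    integral_condExp hm
  have h3 := ProbabilityTheory.variance_nonneg (μ[X | m]) μ
  have h4 := ProbabilityTheory.variance_le_expectation_sq (μ := μ) (X := X) hX.aestronglyMeasurable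
  simp only [Pi.pow_apply] at h4
  linarith

/-- The compensated sums of an adapted sequence with summable second moments converge almost
surely. -/
theorem ae_tendsto_sum_sub_condExp {Ω : Type*} {mΩ : MeasurableSpace Ω} {μ : Measure Ω}
    [IsProbabilityMeasure μ] (F : Filtration ℕ mΩ) {Y : ℕ → Ω → ℝ}
    (hY : ∀ k, StronglyMeasurable[F (k + 1)] (Y k)) (hL2 : ∀ k, MemLp (Y k) 2 μ)
    (hs : Summable fun k => ∫ ω, Y k ω ^ 2 ∂μ) :
    ∀ᵐ ω ∂μ, ∃ z, Tendsto
      (fun n => ∑ k ∈ Finset.range n, (Y k ω - (μ[Y k | F k]) ω)) atTop (𝓝 z) := by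
  set D : ℕ → Ω → ℝ := fun k => Y k - μ[Y k | F k] with hD
  set M : ℕ → Ω → ℝ := fun n => ∑ k ∈ Finset.range n, D k with hMdef
  have hDL2 : ∀ k, MemLp (D k) 2 μ := fun k => (hL2 k).sub ((hL2 k).condExp one_le_two)
  have hML2 : ∀ n, MemLp (M n) 2 μ := fun n => memLp_finsetSum' _ fun k _ => hDL2 k
  have hDm : ∀ k, StronglyMeasurable[F (k + 1)] (D k) := fun k =>
    (hY k).sub (stronglyMeasurable_condExp.mono (F.mono (Nat.le_succ k)))
  have hMm : StronglyAdapted F M := fun n =>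
    Finset.stronglyMeasurable_sum _ fun k hk =>
      (hDm k).mono (F.mono (Finset.mem_range.1 hk))
  have hD0 : ∀ k, μ[D k | F k] =ᵐ[μ] 0 := fun k => by
    have h1 := condExp_sub ((hL2 k).integrable one_le_two)
      (integrable_condExp (m := F k) (μ := μ) (f := Y k)) (F k)
    rw [condExp_of_stronglyMeasurable (F.le k) stronglyMeasurable_condExp integrable_condExp,
      sub_self] at h1
    exact h1
  have hMsucc : ∀ n, M (n + 1) = M n + D n := fun n => Finset.sum_range_succ _ _
  have hmart : Martingale M F μ :=
    martingale_of_condExp_sub_eq_zero_nat hMm (fun n => (hML2 n).integrable one_le_two) fun n => by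
      rw [hMsucc, add_sub_cancel_left]
      exact hD0 n
  -- `M n` involves only `D k` with `k < n`, so it is known at time `n` and orthogonal to the next
  -- increment.
  have horth : ∀ n, ∫ ω, M n ω * D n ω ∂μ = 0 := fun n => by
    have hint : Integrable (M n * D n) μ := (hML2 n).integrable_mul (hDL2 n)
    have h1 := condExp_mul_of_stronglyMeasurable_left (hMm n) hint
      ((hDL2 n).integrable one_le_two)
    have h2 : μ[M n * D n | F n] =ᵐ[μ] 0 := by
      filter_upwards [h1, hD0 n] with ω e1 e2
      rw [e1, Pi.mul_apply, e2, Pi.zero_apply, mul_zero]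
    have h3 := integral_condExp (F.le n) (μ := μ) (f := M n * D n)
    rw [integral_congr_ae h2] at h3
    simpa using h3.symm
  have hsq : ∀ n, ∫ ω, M n ω ^ 2 ∂μ ≤ ∑ k ∈ Finset.range n, ∫ ω, Y k ω ^ 2 ∂μ := by
    intro n
    induction n with
    | zero => simp [hMdef]
    | succ n ih =>
      have e1 : (fun ω => M (n + 1) ω ^ 2) =
          fun ω => (M n ω ^ 2 + 2 * (M n ω * D n ω)) + D n ω ^ 2 := by
        funext ω
        rw [hMsucc, Pi.add_apply]
        ring
      have i1 := (hML2 n).integrable_sq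
      have i2 : Integrable (fun ω => M n ω * D n ω) μ := (hML2 n).integrable_mul (hDL2 n)
      have i3 := (hDL2 n).integrable_sq
      have i12 : Integrable (fun ω => M n ω ^ 2 + 2 * (M n ω * D n ω)) μ := i1.add (i2.const_mul 2)
      rw [e1, integral_add i12 i3, integral_add i1 (i2.const_mul 2),
        integral_const_mul, horth n, Finset.sum_range_succ]
      have := integral_sub_condExp_sq_le (F.le n) (hL2 n)
      have e2 : ∫ ω, D n ω ^ 2 ∂μ = ∫ ω, (Y n ω - (μ[Y n | F n]) ω) ^ 2 ∂μ := rfl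
      linarith
  -- Martingale convergence needs an `L¹` bound, obtained from the second moments by `|x| ≤ 1 + x ^
  -- 2`.
  have hbdd : ∀ n, eLpNorm (M n) 1 μ ≤ ((1 + ∑' k, ∫ ω, Y k ω ^ 2 ∂μ).toNNReal : ENNReal) := by
    intro n
    have hi := (hML2 n).integrable one_le_two
    rw [eLpNorm_one_eq_lintegral_enorm, ← ofReal_integral_norm_eq_lintegral_enorm hi]
    refine ENNReal.ofReal_le_ofReal ?_
    calc ∫ ω, ‖M n ω‖ ∂μ ≤ ∫ ω, (1 + M n ω ^ 2) ∂μ := by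
          refine integral_mono hi.norm ((integrable_const 1).add (hML2 n).integrable_sq) fun ω => ?_
          simp only [Real.norm_eq_abs]
          nlinarith [sq_abs (M n ω), sq_nonneg (|M n ω| - 1)]
      _ = 1 + ∫ ω, M n ω ^ 2 ∂μ := by
          rw [integral_add (integrable_const 1) (hML2 n).integrable_sq]; simp
      _ ≤ _ := by
          have := hs.sum_le_tsum (Finset.range n) fun k _ =>
            integral_nonneg fun ω => sq_nonneg (Y k ω)
          linarith [hsq n]
  filter_upwards [hmart.submartingale.exists_ae_tendsto_of_bdd hbdd] with ω hω
  obtain ⟨z, hz⟩ := hω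
  refine ⟨z, hz.congr fun n => ?_⟩
  simp [hMdef, hD]

/-- A conditional bound `E[q | m] ≤ H` may be used inside integrals against nonnegative
`m`-measurable functions, without integrability of the product. -/
theorem lintegral_ofReal_mul_le_of_condExp_le {Ω : Type*} {m mΩ : MeasurableSpace Ω} (hm : m ≤ mΩ)
    {μ : Measure Ω} [IsFiniteMeasure μ] {q : Ω → ℝ} (hq : Integrable q μ) (hq0 : ∀ ω, 0 ≤ q ω)
    {H : ℝ} (hH : μ[q | m] ≤ᵐ[μ] fun _ => H) {f : Ω → ENNReal} (hf : Measurable[m] f) :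
    ∫⁻ ω, ENNReal.ofReal (q ω) * f ω ∂μ ≤ ENNReal.ofReal H * ∫⁻ ω, f ω ∂μ := by
  have hqm : AEMeasurable (fun ω => ENNReal.ofReal (q ω)) μ := hq.aemeasurable.ennreal_ofReal
  have hfm : Measurable f := hf.mono hm le_rfl
  have h1 := lintegral_withDensity_eq_lintegral_mul₀ hqm hfm.aemeasurable
  simp only [Pi.mul_apply] at h1
  rw [← h1, ← smul_eq_mul, ← lintegral_smul_measure, ← lintegral_trim hm hf,
    ← lintegral_trim hm hf]
  -- The claim is a comparison of measures on `m`: the measure with density `q`, trimmed to `m`, is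
  -- at most `H` times the trimmed `μ`.
  refine lintegral_mono' (Measure.le_iff.2 fun s hs => ?_) le_rfl
  rw [trim_measurableSet_eq hm hs, trim_measurableSet_eq hm hs, withDensity_apply _ (hm s hs),
    ← ofReal_integral_eq_lintegral_ofReal hq.integrableOn (Eventually.of_forall hq0),
    ← setIntegral_condExp hm hq hs, Measure.smul_apply, smul_eq_mul]
  have h2 := setIntegral_mono_ae (s := s) integrable_condExp.integrableOn
    (integrable_const H).integrableOn hH
  rw [setIntegral_const, smul_eq_mul, mul_comm] at h2
  refine (ENNReal.ofReal_le_ofReal h2).trans ?_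
  rw [ENNReal.ofReal_mul' measureReal_nonneg, ofReal_measureReal]

/-- The product of conditionally centred noise of bounded conditional variance with a known
square-integrable factor is square-integrable and conditionally centred. -/
theorem memLp_mul_of_condExp_sq_le {Ω : Type*} {m mΩ : MeasurableSpace Ω} (hm : m ≤ mΩ)
    {μ : Measure Ω} [IsProbabilityMeasure μ] {η w : Ω → ℝ} {H : ℝ}
    (hη : MemLp η 2 μ) (hη0 : μ[η | m] =ᵐ[μ] 0)
    (hηH : μ[fun ω => η ω ^ 2 | m] ≤ᵐ[μ] fun _ => H)
    (hw : Measurable[m] w) (hw2 : Integrable (fun ω => w ω ^ 2) μ) :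
    MemLp (fun ω => η ω * w ω) 2 μ ∧ ∫ ω, (η ω * w ω) ^ 2 ∂μ ≤ |H| * ∫ ω, w ω ^ 2 ∂μ ∧
      μ[fun ω => η ω * w ω | m] =ᵐ[μ] 0 := by
  have hwm : Measurable w := hw.mono hm le_rfl
  have hmeas : AEStronglyMeasurable (fun ω => η ω * w ω) μ :=
    hη.aestronglyMeasurable.mul hwm.aestronglyMeasurable
  -- Integrability of `(η * w) ^ 2` is part of the goal, so the bound is first proved for the
  -- Lebesgue integral in `ENNReal`.
  have h1 := lintegral_ofReal_mul_le_of_condExp_le hm hη.integrable_sq (fun ω => sq_nonneg _) hηH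
    (f := fun ω => ENNReal.ofReal (w ω ^ 2))
    (hw.pow_const 2).ennreal_ofReal
  rw [← ofReal_integral_eq_lintegral_ofReal hw2 (Eventually.of_forall fun ω => sq_nonneg _)] at h1
  have h2 : ∫⁻ ω, ENNReal.ofReal ((η ω * w ω) ^ 2) ∂μ ≤
      ENNReal.ofReal (|H| * ∫ ω, w ω ^ 2 ∂μ) := by
    rw [ENNReal.ofReal_mul (abs_nonneg H)]
    refine le_trans (le_of_eq ?_) (h1.trans (mul_le_mul_left
      (ENNReal.ofReal_le_ofReal (le_abs_self H)) _))
    refine lintegral_congr fun ω => ?_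
    rw [mul_pow, ENNReal.ofReal_mul (sq_nonneg _)]
  have hint : Integrable (fun ω => (η ω * w ω) ^ 2) μ := by
    refine ⟨hmeas.pow 2, ?_⟩
    rw [hasFiniteIntegral_iff_ofReal (Eventually.of_forall fun ω => sq_nonneg _)]
    exact h2.trans_lt ENNReal.ofReal_lt_top
  have hL2 : MemLp (fun ω => η ω * w ω) 2 μ := (memLp_two_iff_integrable_sq hmeas).2 hint
  refine ⟨hL2, ?_, ?_⟩
  · rw [← ofReal_integral_eq_lintegral_ofReal hint (Eventually.of_forall fun ω => sq_nonneg _)] at h2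
    exact (ENNReal.ofReal_le_ofReal_iff
      (mul_nonneg (abs_nonneg H) (integral_nonneg fun ω => sq_nonneg _))).1 h2
  · have h3 := condExp_mul_of_stronglyMeasurable_right (μ := μ) (f := η) (g := w)
      hw.stronglyMeasurable (hL2.integrable one_le_two) (hη.integrable one_le_two)
    filter_upwards [h3, hη0] with ω e1 e2
    have e3 : (μ[fun ω => η ω * w ω | m]) ω = (μ[η * w | m]) ω := rfl
    rw [e3, e1, Pi.mul_apply, e2, Pi.zero_apply, zero_mul]

/-- A function whose square is dominated by an integrable function is square-integrable. -/
theorem memLp_two_of_sq_le {Ω : Type*} {mΩ : MeasurableSpace Ω} {μ : Measure Ω} {f h : Ω → ℝ}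
    (hf : AEStronglyMeasurable f μ) (hh : Integrable h μ) (hfh : ∀ᵐ ω ∂μ, f ω ^ 2 ≤ h ω) :
    MemLp f 2 μ ∧ ∫ ω, f ω ^ 2 ∂μ ≤ ∫ ω, h ω ∂μ :=
  ⟨(memLp_two_iff_integrable_sq hf).2 (hh.mono' (hf.pow 2) (by
    filter_upwards [hfh] with ω hω
    rwa [Real.norm_of_nonneg (sq_nonneg _)])),
   integral_mono_of_nonneg (Eventually.of_forall fun ω => sq_nonneg _) hh hfh⟩

/-! ### Moments and bias of the gradient estimate -/

/-- Moments of one coordinate of a two-query gradient estimate, decomposed into the linear part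
`⟨u, V⟩ W`, a remainder `r W` of third order in the perturbation, and the noise `η W`. -/
theorem gradientEstimate_moments {d : ℕ} {Ω : Type*} {m₀ m₁ mΩ : MeasurableSpace Ω}
    (h01 : m₀ ≤ m₁) (h1 : m₁ ≤ mΩ) {μ : Measure Ω} [IsProbabilityMeasure μ]
    {u V W : Ω → EuclideanSpace ℝ (Fin d)} {r η : Ω → ℝ} {Γ B D H : ℝ}
    (hu : Measurable[m₀] u) (huΓ : ∀ ω, ‖u ω‖ ≤ Γ) (hV : Measurable V) (hW : Measurable[m₁] W)
    (hcross : ∀ i j, Integrable (fun ω => W ω i * V ω j) μ ∧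
      μ[fun ω => W ω i * V ω j | m₀] =ᵐ[μ] fun _ => (1 : Matrix (Fin d) (Fin d) ℝ) i j)
    (hW2 : Integrable (fun ω => ‖W ω‖ ^ 2) μ) (hW2D : μ[fun ω => ‖W ω‖ ^ 2 | m₀] ≤ᵐ[μ] fun _ => D)
    (hVW : Integrable (fun ω => ‖V ω‖ ^ 6 * ‖W ω‖ ^ 2) μ)
    (hVWD : μ[fun ω => ‖V ω‖ ^ 6 * ‖W ω‖ ^ 2 | m₀] ≤ᵐ[μ] fun _ => D)
    (hr : Measurable r) (hB : 0 ≤ B) (hrB : ∀ᵐ ω ∂μ, |r ω| ≤ B * ‖V ω‖ ^ 3)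
    (hη : MemLp η 2 μ) (hη0 : μ[η | m₁] =ᵐ[μ] 0)
    (hηH : μ[fun ω => η ω ^ 2 | m₁] ≤ᵐ[μ] fun _ => H) (i : Fin d) :
    MemLp (fun ω => (inner ℝ (u ω) (V ω) + r ω + η ω) * W ω i) 2 μ ∧
    ∫ ω, ((inner ℝ (u ω) (V ω) + r ω + η ω) * W ω i) ^ 2 ∂μ ≤
      3 * (Γ ^ 2 * (2 * D) + B ^ 2 * D + |H| * D) ∧
    ∀ᵐ ω ∂μ, |(μ[fun ω => (inner ℝ (u ω) (V ω) + r ω + η ω) * W ω i | m₀]) ω - u ω i| ≤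
      B * (1 + D) := by
  have h0 : m₀ ≤ mΩ := h01.trans h1
  have hum : Measurable u := hu.mono h0 le_rfl
  have hWm : Measurable W := hW.mono h1 le_rfl
  have hcoord : ∀ j, Measurable fun v : EuclideanSpace ℝ (Fin d) => v j := fun j =>
    (EuclideanSpace.proj (𝕜 := ℝ) j).continuous.measurable
  have hWi : Measurable fun ω => W ω i := (hcoord i).comp hWm
  have hWile : ∀ ω, |W ω i| ≤ ‖W ω‖ := fun ω => PiLp.norm_apply_le (W ω) i
  have hWisq : ∀ ω, W ω i ^ 2 ≤ ‖W ω‖ ^ 2 := fun ω => by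
    rw [← sq_abs]
    exact pow_le_pow_left₀ (abs_nonneg _) (hWile ω) 2
  have hintle : ∀ f : Ω → ℝ, μ[f | m₀] ≤ᵐ[μ] (fun _ => D) → ∫ ω, f ω ∂μ ≤ D := fun f hf => by
    rw [← integral_condExp h0]
    simpa using integral_mono_ae integrable_condExp (integrable_const D) hf
  have hW2i := hintle _ hW2D
  have hVWi := hintle _ hVWD
  have hD0 : 0 ≤ D := (integral_nonneg fun ω => sq_nonneg ‖W ω‖).trans hW2i
  have hWi2 : Integrable (fun ω => W ω i ^ 2) μ :=
    hW2.mono' (hWi.pow_const 2).aestronglyMeasurable (Eventually.of_forall fun ω => by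
      rw [Real.norm_of_nonneg (sq_nonneg _)]; exact hWisq ω)
  have hWi2D : ∫ ω, W ω i ^ 2 ∂μ ≤ D := (integral_mono hWi2 hW2 hWisq).trans hW2i
  -- the linear part
  obtain ⟨l1, l2⟩ := memLp_two_of_sq_le (μ := μ) (f := fun ω => inner ℝ (u ω) (V ω) * W ω i)
    (h := fun ω => Γ ^ 2 * (‖W ω‖ ^ 2 + ‖V ω‖ ^ 6 * ‖W ω‖ ^ 2))
    ((hum.inner hV).mul hWi).aestronglyMeasurable ((hW2.add hVW).const_mul _)
    (Eventually.of_forall fun ω => by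
      have e1 : (inner ℝ (u ω) (V ω)) ^ 2 ≤ Γ ^ 2 * ‖V ω‖ ^ 2 := by
        rw [← sq_abs, ← mul_pow]
        exact pow_le_pow_left₀ (abs_nonneg _) ((abs_real_inner_le_norm _ _).trans
          (mul_le_mul_of_nonneg_right (huΓ ω) (norm_nonneg _))) 2
      -- Interpolates between the two available moments, `‖W‖ ^ 2` and `‖V‖ ^ 6 * ‖W‖ ^ 2`.
      have e2 : ‖V ω‖ ^ 2 ≤ 1 + ‖V ω‖ ^ 6 := by
        have e3 : (0 : ℝ) ≤ ‖V ω‖ ^ 2 := by positivity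
        have e4 : ‖V ω‖ ^ 6 = (‖V ω‖ ^ 2) ^ 3 := by ring
        rw [e4]
        generalize ‖V ω‖ ^ 2 = t at *
        nlinarith [mul_nonneg e3 (sq_nonneg (t - 1)), sq_nonneg (t - 1)]
      calc (inner ℝ (u ω) (V ω) * W ω i) ^ 2 = (inner ℝ (u ω) (V ω)) ^ 2 * W ω i ^ 2 := by ring
        _ ≤ (Γ ^ 2 * (1 + ‖V ω‖ ^ 6)) * ‖W ω‖ ^ 2 :=
          mul_le_mul (e1.trans (mul_le_mul_of_nonneg_left e2 (sq_nonneg Γ))) (hWisq ω)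
            (sq_nonneg _) (by positivity)
        _ = Γ ^ 2 * (‖W ω‖ ^ 2 + ‖V ω‖ ^ 6 * ‖W ω‖ ^ 2) := by ring)
  rw [integral_const_mul, integral_add hW2 hVW] at l2
  have l3 : μ[fun ω => inner ℝ (u ω) (V ω) * W ω i | m₀] =ᵐ[μ] fun ω => u ω i := by
    have hum' : ∀ j, StronglyMeasurable[m₀] fun ω => u ω j := fun j =>
      ((hcoord j).comp hu).stronglyMeasurable
    have hub : ∀ j, ∀ᵐ ω ∂μ, ‖u ω j‖ ≤ Γ := fun j =>
      Eventually.of_forall fun ω => (PiLp.norm_apply_le (u ω) j).trans (huΓ ω)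
    have e1 : (fun ω => inner ℝ (u ω) (V ω) * W ω i) =
        ∑ j, (fun ω => u ω j) * fun ω => W ω i * V ω j := by
      funext ω
      rw [Finset.sum_apply, PiLp.inner_apply, Finset.sum_mul]
      refine Finset.sum_congr rfl fun j _ => ?_
      simp only [Pi.mul_apply, RCLike.inner_apply, conj_trivial]
      ring
    have e2 := condExp_finsetSum (μ := μ) (s := Finset.univ)
      (f := fun j => (fun ω => u ω j) * fun ω => W ω i * V ω j)
      (fun j _ => (hcross i j).1.bdd_mul ((hum' j).mono h0).aestronglyMeasurable (hub j)) m₀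
    have e3 := fun j => condExp_stronglyMeasurable_mul_of_bound h0 (hum' j) (hcross i j).1 Γ (hub j)
    rw [e1]
    filter_upwards [e2, ae_all_iff.2 e3, ae_all_iff.2 fun j => (hcross i j).2] with ω a1 a2 a3
    rw [a1, Finset.sum_apply]
    simp only [a2, Pi.mul_apply, a3, Matrix.one_apply]
    simp
  -- the remainder
  obtain ⟨r1, r2⟩ := memLp_two_of_sq_le (μ := μ) (f := fun ω => r ω * W ω i)
    (h := fun ω => B ^ 2 * (‖V ω‖ ^ 6 * ‖W ω‖ ^ 2))
    (hr.mul hWi).aestronglyMeasurable (hVW.const_mul _) (by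
      filter_upwards [hrB] with ω hω
      have e1 : r ω ^ 2 ≤ B ^ 2 * ‖V ω‖ ^ 6 := by
        rw [← sq_abs]
        refine (pow_le_pow_left₀ (abs_nonneg _) hω 2).trans (le_of_eq (by ring))
      rw [mul_pow, ← mul_assoc]
      exact mul_le_mul e1 (hWisq ω) (sq_nonneg _) (by positivity))
  rw [integral_const_mul] at r2
  have r3 : ∀ᵐ ω ∂μ, |(μ[fun ω => r ω * W ω i | m₀]) ω| ≤ B * (1 + D) := by
    have hdom : Integrable (fun ω => B * (1 + ‖V ω‖ ^ 6 * ‖W ω‖ ^ 2)) μ :=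
      ((integrable_const 1).add hVW).const_mul B
    have e1 := abs_condExp_ae_le_condExp_abs (μ := μ) (m := m₀) (fun ω => r ω * W ω i)
    have e2 : μ[|fun ω => r ω * W ω i| | m₀] ≤ᵐ[μ]
        μ[fun ω => B * (1 + ‖V ω‖ ^ 6 * ‖W ω‖ ^ 2) | m₀] := by
      refine condExp_mono (r1.integrable one_le_two).abs hdom ?_
      filter_upwards [hrB] with ω hω
      have e3 : ‖V ω‖ ^ 3 * ‖W ω‖ ≤ 1 + ‖V ω‖ ^ 6 * ‖W ω‖ ^ 2 := by
        have : ‖V ω‖ ^ 6 * ‖W ω‖ ^ 2 = (‖V ω‖ ^ 3 * ‖W ω‖) ^ 2 := by ring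
        rw [this]
        nlinarith [sq_nonneg (‖V ω‖ ^ 3 * ‖W ω‖ - 1)]
      calc |r ω * W ω i| = |r ω| * |W ω i| := abs_mul _ _
        _ ≤ (B * ‖V ω‖ ^ 3) * ‖W ω‖ := mul_le_mul hω (hWile ω) (abs_nonneg _) (by positivity)
        _ = B * (‖V ω‖ ^ 3 * ‖W ω‖) := by ring
        _ ≤ _ := mul_le_mul_of_nonneg_left e3 hB
    have e4 : μ[fun ω => B * (1 + ‖V ω‖ ^ 6 * ‖W ω‖ ^ 2) | m₀] =ᵐ[μ]
        fun ω => B * (1 + (μ[fun ω => ‖V ω‖ ^ 6 * ‖W ω‖ ^ 2 | m₀]) ω) := by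
      have a1 := condExp_smul (μ := μ) B (fun ω => 1 + ‖V ω‖ ^ 6 * ‖W ω‖ ^ 2) m₀
      have a2 := condExp_add (μ := μ) (integrable_const (1 : ℝ)) hVW m₀
      rw [condExp_const h0] at a2
      filter_upwards [a1, a2] with ω a1 a2
      refine a1.trans ?_
      rw [Pi.smul_apply, smul_eq_mul]
      exact congrArg _ a2
    filter_upwards [e1, e2, e4, hVWD] with ω e1 e2 e4 e5
    refine (le_trans e1 e2).trans ?_
    rw [e4]
    exact mul_le_mul_of_nonneg_left (by linarith) hB
  -- the noise
  obtain ⟨n1, n2, n3⟩ := memLp_mul_of_condExp_sq_le (w := fun ω => W ω i) h1 hη hη0 hηH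
    ((hcoord i).comp hW) hWi2
  -- Centring holds given `m₁`, where `W` is known; the tower property carries it down to `m₀`.
  have n4 : μ[fun ω => η ω * W ω i | m₀] =ᵐ[μ] 0 := by
    have e1 := condExp_condExp_of_le (μ := μ) (f := fun ω => η ω * W ω i) h01 h1
    have e2 := condExp_congr_ae (m := m₀) n3
    rw [condExp_zero] at e2
    exact e1.symm.trans e2
  have hsplit : (fun ω => (inner ℝ (u ω) (V ω) + r ω + η ω) * W ω i) =
      ((fun ω => inner ℝ (u ω) (V ω) * W ω i) + fun ω => r ω * W ω i) +
        fun ω => η ω * W ω i := by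
    funext ω
    simp only [Pi.add_apply]
    ring
  refine ⟨?_, ?_, ?_⟩
  · rw [hsplit]
    exact (l1.add r1).add n1
  · have e1 : ∫ ω, ((inner ℝ (u ω) (V ω) + r ω + η ω) * W ω i) ^ 2 ∂μ ≤
        ∫ ω, 3 * (((inner ℝ (u ω) (V ω) * W ω i) ^ 2 + (r ω * W ω i) ^ 2) +
          (η ω * W ω i) ^ 2) ∂μ := by
      refine integral_mono_of_nonneg (Eventually.of_forall fun ω => sq_nonneg _)
        (((l1.integrable_sq.add r1.integrable_sq).add n1.integrable_sq).const_mul 3)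
        (Eventually.of_forall fun ω => ?_)
      simp only
      rw [add_mul, add_mul]
      generalize inner ℝ (u ω) (V ω) * W ω i = p
      generalize r ω * W ω i = q
      generalize η ω * W ω i = s
      nlinarith [sq_nonneg (p - q), sq_nonneg (p - s), sq_nonneg (q - s)]
    have i12 : Integrable (fun ω => (inner ℝ (u ω) (V ω) * W ω i) ^ 2 + (r ω * W ω i) ^ 2) μ :=
      l1.integrable_sq.add r1.integrable_sq
    rw [integral_const_mul, integral_add i12 n1.integrable_sq,
      integral_add l1.integrable_sq r1.integrable_sq] at e1
    refine e1.trans (mul_le_mul_of_nonneg_left ?_ (by norm_num))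
    have b1 := mul_le_mul_of_nonneg_left (add_le_add hW2i hVWi) (sq_nonneg Γ)
    have b2 := mul_le_mul_of_nonneg_left hVWi (sq_nonneg B)
    have b3 := mul_le_mul_of_nonneg_left hWi2D (abs_nonneg H)
    linarith
  · rw [hsplit]
    have e1 := condExp_add (μ := μ) ((l1.add r1).integrable one_le_two)
      (n1.integrable one_le_two) m₀
    have e2 := condExp_add (μ := μ) (l1.integrable one_le_two) (r1.integrable one_le_two) m₀
    filter_upwards [e1, e2, l3, r3, n4] with ω e1 e2 e3 e4 e5
    rw [e1, Pi.add_apply, e2, Pi.add_apply, e3, e5, Pi.zero_apply, add_zero, add_sub_cancel_left]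
    exact e4

theorem continuous_gradient_of_contDiff {d : ℕ} {L : EuclideanSpace ℝ (Fin d) → ℝ}
    (hL : ContDiff ℝ 1 L) : Continuous (gradient L) :=
  (InnerProductSpace.toDual ℝ (EuclideanSpace ℝ (Fin d))).symm.continuous.comp
    (hL.continuous_fderiv one_ne_zero)

/-- Multiplying conditionally centred noise by a bounded known factor keeps it centred and scales
the bound on the conditional second moment. -/
theorem condExp_bdd_mul_noise {Ω : Type*} {m mΩ : MeasurableSpace Ω} (hm : m ≤ mΩ)
    {μ : Measure Ω} [IsProbabilityMeasure μ] {s η : Ω → ℝ} {κ H : ℝ} (hs : Measurable[m] s)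
    (hsκ : ∀ ω, |s ω| ≤ κ) (hη : MemLp η 2 μ) (hη0 : μ[η | m] =ᵐ[μ] 0)
    (hηH : μ[fun ω => η ω ^ 2 | m] ≤ᵐ[μ] fun _ => H) :
    MemLp (fun ω => s ω * η ω) 2 μ ∧ μ[fun ω => s ω * η ω | m] =ᵐ[μ] 0 ∧
      μ[fun ω => (s ω * η ω) ^ 2 | m] ≤ᵐ[μ] fun _ => κ ^ 2 * |H| := by
  have hssq : ∀ ω, s ω ^ 2 ≤ κ ^ 2 := fun ω => by
    rw [← sq_abs]
    exact pow_le_pow_left₀ (abs_nonneg _) (hsκ ω) 2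
  refine ⟨(memLp_two_of_sq_le (h := fun ω => κ ^ 2 * η ω ^ 2)
    ((hs.mono hm le_rfl).aestronglyMeasurable.mul hη.aestronglyMeasurable)
    (hη.integrable_sq.const_mul _) (Eventually.of_forall fun ω => ?_)).1, ?_, ?_⟩
  · rw [Pi.mul_apply, mul_pow]
    exact mul_le_mul_of_nonneg_right (hssq ω) (sq_nonneg _)
  · filter_upwards [condExp_stronglyMeasurable_mul_of_bound hm hs.stronglyMeasurable
      (hη.integrable one_le_two) κ (Eventually.of_forall hsκ), hη0] with ω e1 e2
    refine Eq.trans e1 ?_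
    rw [Pi.mul_apply, e2, Pi.zero_apply, mul_zero]
  · have hs2 : StronglyMeasurable[m] fun ω => s ω ^ 2 := (hs.pow_const 2).stronglyMeasurable
    have e0 : (fun ω => (s ω * η ω) ^ 2) = (fun ω => s ω ^ 2) * fun ω => η ω ^ 2 := by
      funext ω
      rw [mul_pow, Pi.mul_apply]
    rw [e0]
    filter_upwards [condExp_stronglyMeasurable_mul_of_bound hm hs2 hη.integrable_sq (κ ^ 2)
      (Eventually.of_forall fun ω => by
        rw [Real.norm_of_nonneg (sq_nonneg _)]; exact hssq ω), hηH] with ω e1 e2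
    rw [e1, Pi.mul_apply]
    exact (mul_le_mul_of_nonneg_left (e2.trans (le_abs_self H)) (sq_nonneg _)).trans
      (mul_le_mul_of_nonneg_right (hssq ω) (abs_nonneg _))

/-- A jointly measurable map evaluated at a random vector is measurable for the σ-algebra obtained
by adjoining that vector. -/
theorem measurable_uncurry_comp_sup_comap {Ω α β : Type*} {m : MeasurableSpace Ω}
    [MeasurableSpace α] [mβ : MeasurableSpace β] {f : Ω → α → β}
    (hf : Measurable[m.prod inferInstance] fun p : Ω × α => f p.1 p.2) (V : Ω → α) :
    Measurable[m ⊔ MeasurableSpace.comap V inferInstance] fun ω => f ω (V ω) := by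
  have hV : Measurable[m ⊔ MeasurableSpace.comap V inferInstance] V :=
    (comap_measurable V).mono le_sup_right le_rfl
  have hid : Measurable[m ⊔ MeasurableSpace.comap V inferInstance, m] (id : Ω → Ω) :=
    measurable_id'' le_sup_left
  exact hf.comp
    (Measurable.prodMk hid hV)

/-- Second moment and conditional bias of the increments of the iteration, truncated to the event
that the current iterate is bounded by `N`. -/
theorem exists_truncated_increment_moments {d : ℕ} {Ω Ξ : Type*} [mΩ : MeasurableSpace Ω]
    [MeasurableSpace Ξ] {μ : Measure Ω} [IsProbabilityMeasure μ] {P : Measure Ξ}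
    {F : Filtration ℕ mΩ} {l : EuclideanSpace ℝ (Fin d) → Ξ → ℝ} {a c : ℕ → ℝ}
    {Δ : ℕ → Ω → EuclideanSpace ℝ (Fin d)}
    {m : ℕ → Ω → EuclideanSpace ℝ (Fin d) → EuclideanSpace ℝ (Fin d)}
    {S : ℕ → Ω → Matrix (Fin d) (Fin d) ℝ} {ξp ξm : ℕ → Ω → Ξ}
    {θ : ℕ → Ω → EuclideanSpace ℝ (Fin d)}
    (hmodel : IsLossModel P l) (hiter : IsSAIteration F l a c Δ m ξp ξm θ)
    (hloss : LossCondition μ (expectedLoss P l) c Δ θ) (hpert : PerturbationCondition μ F Δ m S)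
    (hnoise : NoiseCondition μ F P l c Δ θ ξp ξm) (hstep : StepsizeCondition a c) :
    ∃ (K : ℕ) (C : ℝ), ∀ N : ℝ, ∃ Q : ℝ, ∀ k ≥ K, ∀ i,
      MemLp (fun ω => if ‖θ k ω‖ ≤ N then θ k ω i - θ (k + 1) ω i else 0) 2 μ ∧
      ∫ ω, (if ‖θ k ω‖ ≤ N then θ k ω i - θ (k + 1) ω i else 0) ^ 2 ∂μ ≤
        Q * (a k ^ 2 / c k ^ 2) ∧
      ∀ᵐ ω ∂μ, ‖θ k ω‖ ≤ N →
        |(μ[fun ω => if ‖θ k ω‖ ≤ N then θ k ω i - θ (k + 1) ω i else 0 | F k]) ω -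
          a k * gradient (expectedLoss P l) (θ k ω) i| ≤ a k * (C * c k ^ 2) := by
  obtain ⟨K₁, D₁, hD₁⟩ := hloss
  obtain ⟨D₂, hD₂⟩ := hpert.moment_bound
  obtain ⟨D₃, hD₃⟩ := hnoise
  obtain ⟨K₂, hK₂⟩ := eventually_atTop.1 (hstep.c_tendsto.eventually (ge_mem_nhds one_pos))
  set L := expectedLoss P l with hLdef
  have hg : Continuous (gradient L) := continuous_gradient_of_contDiff hmodel.contDiff_loss
  have hLm : Measurable L := hmodel.contDiff_loss.continuous.measurable
  set A : ℝ := (d : ℝ) ^ 3 * |D₁| with hA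
  have hA0 : 0 ≤ A := by positivity
  -- Neither the starting index nor the bias constant depends on `N`; only `Q` does, through the
  -- gradient bound `Γ` on the `N`-ball.
  refine ⟨max K₁ K₂, A * (1 + D₂), fun N => ?_⟩
  obtain ⟨Γ, hΓ⟩ :=
    (isCompact_closedBall (0 : EuclideanSpace ℝ (Fin d)) N).exists_bound_of_continuousOn
    hg.continuousOn
  refine ⟨3 * (Γ ^ 2 * (2 * D₂) + A ^ 2 * D₂ + |D₃| * D₂), fun k hk i => ?_⟩
  have hck := hstep.c_pos k
  have hak := hstep.a_pos k
  have hck1 : c k ≤ 1 := hK₂ k (le_trans (le_max_right _ _) hk)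
  obtain ⟨⟨hW2, hW2D⟩, hVW, hVWD⟩ := hD₂ k
  obtain ⟨hn1, hn2, hn3⟩ := hD₃ k
  have hD₂0 : 0 ≤ D₂ := by
    have h1 := integral_mono_ae integrable_condExp (integrable_const D₂) hW2D
    rw [integral_condExp (F.le k)] at h1
    simpa using (integral_nonneg fun ω => sq_nonneg ‖m k ω (Δ k ω)‖).trans h1
  have hθF : Measurable[F k] (θ k) := hiter.adapted k
  have hθ : Measurable (θ k) := hθF.mono (F.le k) le_rfl
  have hsetF : MeasurableSet[F k] {ω | ‖θ k ω‖ ≤ N} := by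
    have h : MeasurableSet {x : EuclideanSpace ℝ (Fin d) | ‖x‖ ≤ N} :=
      measurableSet_le measurable_norm measurable_const
    exact hθF h
  set u : Ω → EuclideanSpace ℝ (Fin d) :=
    fun ω => if ‖θ k ω‖ ≤ N then gradient L (θ k ω) else 0 with hu
  set s : Ω → ℝ := fun ω => if ‖θ k ω‖ ≤ N then 1 / (2 * c k) else 0 with hs
  set r : Ω → ℝ := fun ω => if ‖θ k ω‖ ≤ N then
    (L (θ k ω + c k • Δ k ω) - L (θ k ω - c k • Δ k ω)) / (2 * c k) -
      inner ℝ (gradient L (θ k ω)) (Δ k ω) else 0 with hr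
  set ε : Ω → ℝ := fun ω => noiseDifference P l (c k) (θ k ω) (Δ k ω) (ξp k ω) (ξm k ω) with hε
  have hum : Measurable[F k] u :=
    Measurable.ite hsetF (hg.measurable.comp hθF) measurable_const
  have huΓ : ∀ ω, ‖u ω‖ ≤ |Γ| := fun ω => by
    simp only [hu]
    split_ifs with h
    · exact (hΓ _ (by simpa using h)).trans (le_abs_self Γ)
    · simp
  have hsb : ∀ ω, |s ω| ≤ 1 / (2 * c k) := fun ω => by
    have : 0 ≤ 1 / (2 * c k) := by positivity
    simp only [hs]
    split_ifs
    · rw [abs_of_nonneg this]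
    · simpa using this
  have hrm : Measurable r := by
    have hΔ := hpert.measurable_pert k
    exact Measurable.ite (F.le k _ hsetF)
      ((((hLm.comp (hθ.add (hΔ.const_smul (c k)))).sub
        (hLm.comp (hθ.sub (hΔ.const_smul (c k))))).div_const _).sub
        ((hg.measurable.comp hθ).inner hΔ)) measurable_const
  have hrb : ∀ᵐ ω ∂μ, |r ω| ≤ (A * c k ^ 2) * ‖Δ k ω‖ ^ 3 := by
    filter_upwards [hD₁ k (le_trans (le_max_left _ _) hk)] with ω hω
    obtain ⟨U, hU, hseg, hcd, hbd⟩ := hω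
    simp only [hr]
    split_ifs with h
    · have h1 := abs_symmetric_difference_sub_inner_gradient_le hU hseg hcd hbd
      rw [inner_smul_right, norm_smul, Real.norm_of_nonneg hck.le] at h1
      have h2 : (L (θ k ω + c k • Δ k ω) - L (θ k ω - c k • Δ k ω)) / (2 * c k) -
          inner ℝ (gradient L (θ k ω)) (Δ k ω) =
          (L (θ k ω + c k • Δ k ω) - L (θ k ω - c k • Δ k ω) -
            2 * (c k * inner ℝ (gradient L (θ k ω)) (Δ k ω))) / (2 * c k) := by
        field_simp
      rw [h2, abs_div, abs_of_pos (by positivity : 0 < 2 * c k), div_le_iff₀ (by positivity)]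
      refine h1.trans (le_of_eq ?_)
      rw [hA]
      ring
    · rw [abs_zero]; positivity
  have hFG : F k ≤ F k ⊔ MeasurableSpace.comap (Δ k) inferInstance := le_sup_left
  have hG : F k ⊔ MeasurableSpace.comap (Δ k) inferInstance ≤ mΩ :=
    sup_le (F.le k) (hpert.measurable_pert k).comap_le
  have hWG := measurable_uncurry_comp_sup_comap (hpert.measurable_map k) (Δ k)
  have hsm : Measurable[F k] s := Measurable.ite hsetF measurable_const measurable_const
  obtain ⟨hη1, hη2, hη3⟩ := condExp_bdd_mul_noise hG (hsm.mono hFG le_rfl) hsb hn1 hn2 hn3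
  obtain ⟨x1, x2, x3⟩ := gradientEstimate_moments hFG hG hum huΓ (hpert.measurable_pert k) hWG
    (hpert.cross_moment k) hW2 hW2D hVW hVWD hrm (by positivity) hrb hη1 hη2 hη3 i
  set X : Ω → ℝ := fun ω => (inner ℝ (u ω) (Δ k ω) + r ω + s ω * ε ω) * m k ω (Δ k ω) i with hX
  -- An exact identity: the inner products in `u` and `r` cancel, and the loss difference in `r`
  -- recombines with the noise.
  have hY : (fun ω => if ‖θ k ω‖ ≤ N then θ k ω i - θ (k + 1) ω i else 0) = a k • X := by
    funext ω
    rw [Pi.smul_apply, smul_eq_mul]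
    simp only [hX, hu, hs, hr, hε]
    split_ifs with h
    · rw [hiter.step k ω]
      simp only [gradientEstimate, noiseDifference, PiLp.sub_apply, PiLp.smul_apply, smul_eq_mul,
        sub_sub_cancel]
      ring
    · simp
  have hYsq : ∀ ω, (if ‖θ k ω‖ ≤ N then θ k ω i - θ (k + 1) ω i else 0) ^ 2 =
      a k ^ 2 * X ω ^ 2 := fun ω => by
    rw [congrFun hY ω, Pi.smul_apply, smul_eq_mul, mul_pow]
  refine ⟨?_, ?_, ?_⟩
  · rw [hY]
    exact x1.const_smul (a k)
  · simp only [hYsq]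
    rw [integral_const_mul]
    refine (mul_le_mul_of_nonneg_left x2 (sq_nonneg _)).trans ?_
    rw [mul_div_assoc', le_div_iff₀ (by positivity), sq_abs]
    -- Only the noise term is of order `1 / c k ^ 2`; the other terms are absorbed using `c k ≤ 1`.
    have hH : |(1 / (2 * c k)) ^ 2 * (|D₃|)| * c k ^ 2 = |D₃| / 4 := by
      rw [abs_of_nonneg (by positivity)]
      field_simp
      ring
    have hc2 : c k ^ 2 ≤ 1 := pow_le_one₀ hck.le hck1
    have hc6 : c k ^ 6 ≤ 1 := pow_le_one₀ hck.le hck1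
    have e1 : (Γ ^ 2 * (2 * D₂)) * c k ^ 2 ≤ (Γ ^ 2 * (2 * D₂)) * 1 :=
      mul_le_mul_of_nonneg_left hc2 (by positivity)
    have e2 : (A ^ 2 * D₂) * c k ^ 6 ≤ (A ^ 2 * D₂) * 1 :=
      mul_le_mul_of_nonneg_left hc6 (by positivity)
    have e3 : |(1 / (2 * c k)) ^ 2 * (|D₃|)| * D₂ * c k ^ 2 ≤ |D₃| * D₂ := by
      rw [mul_right_comm, hH]
      nlinarith [mul_nonneg (abs_nonneg D₃) hD₂0]
    have e4 : a k ^ 2 * (3 * (Γ ^ 2 * (2 * D₂) + (A * c k ^ 2) ^ 2 * D₂ +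
        |(1 / (2 * c k)) ^ 2 * (|D₃|)| * D₂)) * c k ^ 2 =
        (3 * ((Γ ^ 2 * (2 * D₂)) * c k ^ 2 + (A ^ 2 * D₂) * c k ^ 6 +
          |(1 / (2 * c k)) ^ 2 * (|D₃|)| * D₂ * c k ^ 2)) * a k ^ 2 := by ring
    rw [e4]
    exact mul_le_mul_of_nonneg_right (by linarith) (sq_nonneg _)
  · filter_upwards [x3, condExp_smul (μ := μ) (a k) X (F k)] with ω e1 e2 hω
    rw [hY, e2, Pi.smul_apply, smul_eq_mul]
    have e3 : u ω = gradient L (θ k ω) := if_pos hω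
    rw [e3] at e1
    rw [← mul_sub, abs_mul, abs_of_pos hak]
    refine mul_le_mul_of_nonneg_left (e1.trans (le_of_eq ?_)) hak.le
    ring

/-! ### Almost sure convergence of the iterates -/

theorem theorem1 {d : ℕ} {Ω Ξ : Type*} [mΩ : MeasurableSpace Ω] [MeasurableSpace Ξ]
    (μ : Measure Ω) [IsProbabilityMeasure μ] (P : Measure Ξ) [IsProbabilityMeasure P]
    (F : Filtration ℕ mΩ)
    (l : EuclideanSpace ℝ (Fin d) → Ξ → ℝ)
    (a c : ℕ → ℝ)
    (Δ : ℕ → Ω → EuclideanSpace ℝ (Fin d))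
    (m : ℕ → Ω → EuclideanSpace ℝ (Fin d) → EuclideanSpace ℝ (Fin d))
    (S : ℕ → Ω → Matrix (Fin d) (Fin d) ℝ)
    (ξp ξm : ℕ → Ω → Ξ)
    (θ : ℕ → Ω → EuclideanSpace ℝ (Fin d))
    (θstar : EuclideanSpace ℝ (Fin d))
    (hmodel : IsLossModel P l)
    (hiter : IsSAIteration F l a c Δ m ξp ξm θ)
    (hloss : LossCondition μ (expectedLoss P l) c Δ θ)
    (hpert : PerturbationCondition μ F Δ m S)
    (hnoise : NoiseCondition μ F P l c Δ θ ξp ξm)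
    (hode : ODECondition μ (gradient (expectedLoss P l)) θstar θ)
    (hstep : StepsizeCondition a c) :
    ∀ᵐ ω ∂μ, Tendsto (fun k => θ k ω) atTop (𝓝 θstar) := by
  obtain ⟨K, C, hKC⟩ :=
    exists_truncated_increment_moments hmodel hiter hloss hpert hnoise hstep
  -- Set to `0` before `K`, where no moment bound is available. Integer levels `N` leave only
  -- countably many null sets.
  set Y : ℕ → Fin d → ℕ → Ω → ℝ := fun N i k => if K ≤ k then
    fun ω => if ‖θ k ω‖ ≤ N then θ k ω i - θ (k + 1) ω i else 0 else 0 with hY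
  have hYK : ∀ N i k, K ≤ k → Y N i k =
      fun ω => if ‖θ k ω‖ ≤ N then θ k ω i - θ (k + 1) ω i else 0 := fun N i k hk => if_pos hk
  have hconv : ∀ (N : ℕ) (i : Fin d), ∀ᵐ ω ∂μ, ∃ z, Tendsto
      (fun n => ∑ k ∈ Finset.range n, (Y N i k ω - (μ[Y N i k | F k]) ω)) atTop (𝓝 z) := by
    intro N i
    obtain ⟨Q, hQ⟩ := hKC N
    have hcoord : Measurable fun v : EuclideanSpace ℝ (Fin d) => v i :=
      (EuclideanSpace.proj (𝕜 := ℝ) i).continuous.measurable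
    refine ae_tendsto_sum_sub_condExp F (fun k => ?_) (fun k => ?_) ?_
    · simp only [hY]
      split_ifs with hk
      · have h0 : Measurable[F (k + 1)] (θ k) :=
          (hiter.adapted k).mono (F.mono (Nat.le_succ k)) le_rfl
        have hset : MeasurableSet {x : EuclideanSpace ℝ (Fin d) | ‖x‖ ≤ N} :=
          measurableSet_le measurable_norm measurable_const
        exact (Measurable.ite (h0 hset)
          ((hcoord.comp h0).sub (hcoord.comp (hiter.adapted (k + 1))))
          measurable_const).stronglyMeasurable
      · exact stronglyMeasurable_zero
    · simp only [hY]
      split_ifs with hk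
      · exact (hQ k hk i).1
      · exact MemLp.zero
    · refine (summable_nat_add_iff K).1 (Summable.of_nonneg_of_le
        (fun k => integral_nonneg fun ω => sq_nonneg _) (fun k => ?_)
        ((summable_nat_add_iff K).2 (hstep.sum_ac.mul_left Q)))
      rw [hYK N i (k + K) (Nat.le_add_left K k)]
      exact (hQ (k + K) (Nat.le_add_left K k) i).2.1
  have hbias : ∀ (N : ℕ) (i : Fin d) (k : ℕ), ∀ᵐ ω ∂μ, K ≤ k → ‖θ k ω‖ ≤ N →
      |(μ[Y N i k | F k]) ω - a k * gradient (expectedLoss P l) (θ k ω) i| ≤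
        a k * (C * c k ^ 2) := by
    intro N i k
    by_cases hk : K ≤ k
    · obtain ⟨Q, hQ⟩ := hKC N
      rw [hYK N i k hk]
      filter_upwards [(hQ k hk i).2.2] with ω hω _
      exact hω
    · exact Eventually.of_forall fun ω h => absurd h hk
  filter_upwards [ae_all_iff.2 fun N => ae_all_iff.2 (hconv N),
    ae_all_iff.2 fun N => ae_all_iff.2 fun i => ae_all_iff.2 (hbias N i), hode.bounded,
    hode.recurrent] with ω h1 h2 ⟨M, hM⟩ ⟨A, hA, hAz, hfreq⟩
  obtain ⟨N, hN⟩ := exists_nat_ge M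
  have hθN : ∀ k, ‖θ k ω‖ ≤ N := fun k => (hM k).trans hN
  choose z hz using h1 N
  refine tendsto_of_isAsymptoticallyStable (K := K) (M := M)
    -- The increment splits into its conditional mean `a k • (g + b k)` and the compensated part `S
    -- (k + 1) - S k`.
    (b := fun k => WithLp.toLp 2 fun i =>
      (μ[Y N i k | F k]) ω / a k - gradient (expectedLoss P l) (θ k ω) i)
    (S := fun n => WithLp.toLp 2 fun i =>
      ∑ k ∈ Finset.range n, (Y N i k ω - (μ[Y N i k | F k]) ω))
    (continuous_gradient_of_contDiff hmodel.contDiff_loss) hstep.a_pos hstep.a_tendsto hstep.sum_a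
    hM ?_ ?_ ?_ hode.stable hA hAz hfreq
  · have h0 : Tendsto (fun k => fun i : Fin d =>
        (μ[Y N i k | F k]) ω / a k - gradient (expectedLoss P l) (θ k ω) i) atTop (𝓝 0) := by
      refine tendsto_pi_nhds.2 fun i => squeeze_zero_norm' (a := fun k => C * c k ^ 2) ?_ ?_
      · filter_upwards [eventually_ge_atTop K] with k hk
        have ha := hstep.a_pos k
        have e1 : (μ[Y N i k | F k]) ω / a k - gradient (expectedLoss P l) (θ k ω) i =
            ((μ[Y N i k | F k]) ω - a k * gradient (expectedLoss P l) (θ k ω) i) / a k := by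
          field_simp
        rw [e1, Real.norm_eq_abs, abs_div, abs_of_pos ha, div_le_iff₀ ha, mul_comm _ (a k)]
        exact h2 N i k hk (hθN k)
      · simpa using (hstep.c_tendsto.pow 2).const_mul C
    exact ((PiLp.continuous_toLp 2 fun _ : Fin d => ℝ).tendsto 0).comp h0
  · exact (((PiLp.continuous_toLp 2 fun _ : Fin d => ℝ).tendsto z).comp
      (tendsto_pi_nhds.2 hz)).cauchySeq
  · intro k hk
    have ha := (hstep.a_pos k).ne'
    ext i
    simp only [PiLp.sub_apply, PiLp.smul_apply, PiLp.add_apply, smul_eq_mul,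
      Finset.sum_range_succ, add_sub_cancel_left]
    have e1 : Y N i k ω = θ k ω i - θ (k + 1) ω i := by
      rw [hYK N i k hk]
      exact if_pos (hθN k)
    rw [e1, add_sub_cancel, mul_div_cancel₀ _ ha]
    ring
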